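/- **Definitions.** For an integrable random variable $X$ (or its law) and $\beta\in(0,1)$, the expectile $\mathrm{ex}_\beta(X)$ is the unique $t\in\mathbb R$ with $(1-\beta)\,\mathbb E[(X-t)_+]=\beta\,\mathbb E[(X-t)_-]$, where $(x)_+=\max\{x,0\}$ and $(x)_-=\max\{-x,0\}$. For an integrable random vector $\mathbf X=(X_1,\dots,X_n)$ (or its law) and $\alpha\in(0,1/2)$, the expectile-based diversification quotient is $$\mathrm{DQ}^{\mathrm{ex}}_\alpha(\mathbf X)=\frac{\alpha^*}{\alpha},\qquad \alpha^*=\inf\Big\{\beta\in(0,1):\ \mathrm{ex}_\beta\Big(\sum_{i=1}^nX_i\Big)\le\sum_{i=1}^n\mathrm{ex}_\alpha(X_i)\Big\},\qquad \inf\varnothing=1 .$$ For data $\mathbf X^{(1)},\dots,\mathbf X^{(N)}$ with $S^{(k)}=\sum_{i=1}^nX_i^{(k)}$, let $t^N$ be the sum over $i$ of the expectiles at level $\alpha$ of the empirical distributions of $X_i^{(1)},\dots,X_i^{(N)}$, and $$\widehat{\mathrm{DQ}^{\mathrm{ex}}_\alpha}(N)=\frac1\alpha\,\frac{\sum_{k=1}^N(S^{(k)}-t^N)_+}{\sum_{k=1}^N|S^{(k)}-t^N|}\qquad(0/0:=0).$$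 For an integrable random variable with distribution function $F$ and mean $\mu$, put $$\widetilde F(y)=\frac{yF(y)-\int_{(-\infty,y]}x\,\mathrm dF(x)}{2\big(yF(y)-\int_{(-\infty,y]}x\,\mathrm dF(x)\big)+\mu-y},\qquad \widetilde f=\widetilde F',\qquad \widetilde F^{-1}(p)=\inf\{y:\widetilde F(y)\ge p\}.$$ **Theorem 6.** Let $\alpha\in(0,1/2)$, let $\mathbf X=(X_1,\dots,X_n)$ be a random vector with $\mathbb E[X_i^2]<\infty$ for all $i$, and let $\mathbf X^{(1)},\mathbf X^{(2)},\dots$ be i.i.d. copies of $\mathbf X$. Let $F_i$ be the distribution function of $X_i$ and $G$ that of $S=\sum_{i=1}^nX_i$. Let $t=\sum_{i=1}^n\mathrm{ex}_\alpha(X_i)$, $\theta_1=\mathbb E[(S-t)_+]$, $\theta_2=\mathbb E[|S-t|]$, and, for $i=1,\dots,n$, $y_i=\widetilde F_i^{-1}(1-\alpha)$, $\mu_i=\mathbb E[X_i]$, $\mu_i^-=\mathbb E[(X_i-y_i)_-]$, $D_i=2\mu_i^-+\mu_i-y_i$. Suppose that $\mathbb P(X_i=y_i)=0$ for all $i$ and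 $\mathbb P(S=t)=0$. Then $\theta_2>0$, each $D_i>0$, each $\widetilde F_i$ is differentiable at $y_i$ with $\widetilde f_i(y_i)>0$, $\widehat{\mathrm{DQ}^{\mathrm{ex}}_\alpha}(N)$ is the expectile-based diversification quotient of the empirical joint distribution of $\mathbf X^{(1)},\dots,\mathbf X^{(N)}$ for every $N\ge1$, and, as $N\to\infty$, $$\sqrt N\left(\widehat{\mathrm{DQ}^{\mathrm{ex}}_\alpha}(N)-\mathrm{DQ}^{\mathrm{ex}}_\alpha(\mathbf X)\right)\xrightarrow{d}\mathrm N(0,\sigma^2),\qquad \sigma^2=\mathbf A^\top\Sigma\mathbf A\ \ (\ge 0),\qquad \mathbf A=H\,g^\top .$$ Here $\Sigma$ is the covariance matrix of $$\left((S-t)_+,\ |S-t|,\ (y_1-X_1)\mathbf 1_{\{X_1\le y_1\}},\ X_1,\ \dots,\ (y_n-X_n)\mathbf 1_{\{X_n\le y_n\}},\ X_n\right)^\top,$$ $g=\left(\dfrac1{\alpha\theta_2},\ -\dfrac{\theta_1}{\alpha\theta_2^2}\right)$, and $H$ is the $(2n+2)\times2$ matrix with $$H^\top=\begin{pmatrix}1&0&\frac{1-G(t)}{\widetilde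 f_1(y_1)}\frac{D_1-2\mu_1^-}{D_1^2}&\frac{1-G(t)}{\widetilde f_1(y_1)}\frac{-\mu_1^-}{D_1^2}&\cdots&\frac{1-G(t)}{\widetilde f_n(y_n)}\frac{D_n-2\mu_n^-}{D_n^2}&\frac{1-G(t)}{\widetilde f_n(y_n)}\frac{-\mu_n^-}{D_n^2}\\[4pt]0&1&\frac{1-2G(t)}{\widetilde f_1(y_1)}\frac{D_1-2\mu_1^-}{D_1^2}&\frac{1-2G(t)}{\widetilde f_1(y_1)}\frac{-\mu_1^-}{D_1^2}&\cdots&\frac{1-2G(t)}{\widetilde f_n(y_n)}\frac{D_n-2\mu_n^-}{D_n^2}&\frac{1-2G(t)}{\widetilde f_n(y_n)}\frac{-\mu_n^-}{D_n^2}\end{pmatrix}.$$ ($\mathrm N(0,0)$ is the point mass at $0$.) -/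

import Mathlib

open MeasureTheory ProbabilityTheory Filter
open scoped Topology Matrix

noncomputable section

namespace DQ

/-- The expectile at level `α` of a law `ν` on `ℝ`: the unique number `t` with
`(1 - α) E[(X - t)_+] = α E[(X - t)_-]`, where `X ∼ ν`. -/
def expectile (α : ℝ) (ν : Measure ℝ) : ℝ :=
  Classical.epsilon fun t : ℝ =>
    (1 - α) * ∫ x, max (x - t) 0 ∂ν = α * ∫ x, max (-(x - t)) 0 ∂ν

/-- The diversification quotient at level `α` of a portfolio with joint law `μ` on `ℝⁿ`, based on
a class `ρ` of law-invariant risk measures (functions of the law) indexed by `I = (0, b)`: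
`α* / α` with `α* = inf {β ∈ I : ρ_β (∑ Xᵢ) ≤ ∑ ρ_α (Xᵢ)}` and `inf ∅ = b`. -/
def diversificationQuotient {n : ℕ} (ρ : ℝ → Measure ℝ → ℝ) (b α : ℝ)
    (μ : Measure (Fin n → ℝ)) : ℝ :=
  let A : Set ℝ := {β | β ∈ Set.Ioo 0 b ∧
    ρ β (μ.map fun x => ∑ i, x i) ≤ ∑ i, ρ α (μ.map fun x => x i)}
  open Classical in (if A.Nonempty then sInf A else b) / α

/-- The diversification quotient based on the class of expectiles `(ex_β)`, `β ∈ (0, 1)`. -/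
def dqEx {n : ℕ} (α : ℝ) (μ : Measure (Fin n → ℝ)) : ℝ :=
  diversificationQuotient expectile 1 α μ

/-- The empirical law `N⁻¹ ∑_{k < N} δ_{x_k}` of the first `N` data points. -/
def empiricalLaw {E : Type*} [MeasurableSpace E] (N : ℕ) (x : ℕ → E) : Measure E :=
  (N : ENNReal)⁻¹ • ∑ k ∈ Finset.range N, Measure.dirac (x k)

/-- The empirical estimator of the expectile-based diversification quotient from the first `N`
data vectors: `α⁻¹ ∑ₖ (S⁽ᵏ⁾ - t)_+ / ∑ₖ |S⁽ᵏ⁾ - t|`, where `S⁽ᵏ⁾ = ∑ᵢ xᵢ⁽ᵏ⁾` and `t` is the sum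
of the empirical expectiles of the coordinates. -/
def dqExEstimator {n : ℕ} (α : ℝ) (N : ℕ) (x : ℕ → Fin n → ℝ) : ℝ :=
  let t : ℝ := ∑ i, expectile α (empiricalLaw N fun k => x k i)
  1 / α * ((∑ k ∈ Finset.range N, max ((∑ i, x k i) - t) 0) /
    ∑ k ∈ Finset.range N, |(∑ i, x k i) - t|)

/-- The transformed distribution function: for `X ∼ ν` with distribution function `F`,
`F̃(y) = (y F(y) - ∫_{(-∞, y]} x dF) / (2 (y F(y) - ∫_{(-∞, y]} x dF) + E[X] - y)`. -/
def tildeF (ν : Measure ℝ) (y : ℝ) : ℝ :=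
  (y * cdf ν y - ∫ x in Set.Iic y, x ∂ν) /
    (2 * (y * cdf ν y - ∫ x in Set.Iic y, x ∂ν) + (∫ x, x ∂ν) - y)

/-- The density `f̃` of `F̃`. -/
def tildeDensity (ν : Measure ℝ) (y : ℝ) : ℝ := deriv (tildeF ν) y

/-- The (left-continuous) generalized inverse `F⁻¹(p) = inf {y : F(y) ≥ p}`. -/
def genInverse (F : ℝ → ℝ) (p : ℝ) : ℝ := sInf {y | p ≤ F y}

/-- Labels of the `2n + 2` coordinates: `inl 0`, `inl 1` are the first two, and `inr (i, 0)`,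
`inr (i, 1)` are the two coordinates belonging to the `i`-th component of the portfolio. -/
abbrev Idx (n : ℕ) : Type := Fin 2 ⊕ Fin n × Fin 2

/-- The random vector
`((S - t)_+, |S - t|, (y₁ - X₁) 1{X₁ ≤ y₁}, X₁, …, (yₙ - Xₙ) 1{Xₙ ≤ yₙ}, Xₙ)`
as a function of the value `x` of `(X₁, …, Xₙ)`. -/
def vecV {n : ℕ} (t : ℝ) (y : Fin n → ℝ) (x : Fin n → ℝ) : Idx n → ℝ
  | Sum.inl 0 => max ((∑ i, x i) - t) 0
  | Sum.inl 1 => |(∑ i, x i) - t|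
  | Sum.inr (i, 0) => if x i ≤ y i then y i - x i else 0
  | Sum.inr (i, 1) => x i

/-- The `2 × (2n + 2)` matrix `∇h(v)ᵀ` (`Gt` is `G(t)`, `f i` is `f̃ᵢ(yᵢ)`, `m i` is `μᵢ⁻`). -/
def gradHT {n : ℕ} (Gt : ℝ) (f m D : Fin n → ℝ) : Matrix (Fin 2) (Idx n) ℝ :=
  Matrix.of fun r c =>
    match r, c with
    | 0, Sum.inl 0 => 1
    | 0, Sum.inl 1 => 0
    | 0, Sum.inr (i, 0) => (1 - Gt) / f i * ((D i - 2 * m i) / D i ^ 2)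
    | 0, Sum.inr (i, 1) => (1 - Gt) / f i * (-m i / D i ^ 2)
    | 1, Sum.inl 0 => 0
    | 1, Sum.inl 1 => 1
    | 1, Sum.inr (i, 0) => (1 - 2 * Gt) / f i * ((D i - 2 * m i) / D i ^ 2)
    | 1, Sum.inr (i, 1) => (1 - 2 * Gt) / f i * (-m i / D i ^ 2)

end DQ

end

noncomputable section

namespace DQ

/-! Write `score β z` as (1-β)z₊ - βz₋ = z₊ - β|z|. The expectile is the zero of s ↦ E score β (X -
s), which decreases with slopes between min(β, 1-β) and 1 in absolute value. Hence ex_β(S) ≤ t means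
E(S-t)₊ ≤ β E|S-t|, and the diversification quotient of any integrable law is q/α with q = E(S-t)₊ /
E|S-t| (`dqEx_eq`). Applied to the empirical law, this gives the estimator.

Fix the population value q = θ₁/θ₂, and let b_N be the sample mean of |S - t^N|. The estimation
error is the sample mean of score_q(S - t^N), divided by α b_N. Moving t^N to t, and each empirical
expectile T_i to y_i, costs an increment times a difference quotient of a sample mean of scores. As
T_i annihilates its own empirical score, T_i - y_i is minus the sample mean of score_α(X_i - y_i)
over such a quotient. So the error is exactly a combination of n+1 sample means of fixed centred
scores, with random coefficients (`sub_eq_of_slopes`).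

The coefficients converge almost surely: the expectiles are consistent, and the difference quotients
converge because t and the y_i are not atoms (`ae_tendsto_slopeOr`). Slutsky's lemma
(`tendstoInDistribution_sum_mul`) puts the limits in their place, and one scalar central limit
theorem finishes. Its variance is AᵀΣA because the limiting combination differs from A·V by a
constant (`dotProduct_vecV`). -/

/-! ### The score and its increments. -/

/-- The identification function of the expectile at level `β`. -/
def score (β z : ℝ) : ℝ := (1 - β) * max z 0 - β * max (-z) 0

theorem score_eq (β z : ℝ) : score β z = max z 0 - β * |z| := by
  unfold score
  rcases le_total 0 z with h | h
  · rw [max_eq_left h, max_eq_right (by linarith), abs_of_nonneg h]; ring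
  · rw [max_eq_right h, max_eq_left (by linarith), abs_of_nonpos h]; ring

theorem continuous_score (β : ℝ) : Continuous (score β) := by
  unfold score; fun_prop

theorem measurable_score (β : ℝ) : Measurable (score β) := (continuous_score β).measurable

/-- Increments of the score, as the threshold moves from `t` to `s`. -/
theorem score_increment {β : ℝ} (h0 : 0 ≤ β) (h1 : β ≤ 1) (x s t : ℝ) :
    |score β (x - s) - score β (x - t)
        - (s - t) * (-(1 - β + (2 * β - 1) * (if x ≤ t then 1 else 0)))|
      ≤ |s - t| * (if |x - t| ≤ |s - t| then 1 else 0) := by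
  unfold score
  have e1 : ∀ z : ℝ, (0 ≤ z ∧ max z 0 = z ∧ max (-z) 0 = 0) ∨
      (z < 0 ∧ max z 0 = 0 ∧ max (-z) 0 = -z) := fun z => by
    rcases le_or_gt 0 z with h | h
    · exact Or.inl ⟨h, max_eq_left h, max_eq_right (by linarith)⟩
    · exact Or.inr ⟨h, max_eq_right h.le, max_eq_left (by linarith)⟩
  -- The score is affine on each side of 0. If x is farther from t than s is, then x - s and x - t
  -- have the same sign and the linearization is exact; otherwise two slopes from [0, 1] differ by
  -- at most 1.
  by_cases hc : |x - t| ≤ |s - t|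
  · rw [if_pos hc, mul_one]
    rcases le_total s t with hst | hst
    · rw [abs_of_nonpos (by linarith : s - t ≤ 0)] at hc ⊢
      rw [abs_le] at hc
      rcases e1 (x - s) with ⟨a, b, c⟩ | ⟨a, b, c⟩ <;>
      rcases e1 (x - t) with ⟨a', b', c'⟩ | ⟨a', b', c'⟩ <;>
      rw [b, c, b', c'] <;> split_ifs with hx <;> rw [abs_le] <;> constructor <;> nlinarith
    · rw [abs_of_nonneg (by linarith : 0 ≤ s - t)] at hc ⊢
      rw [abs_le] at hc
      rcases e1 (x - s) with ⟨a, b, c⟩ | ⟨a, b, c⟩ <;>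
      rcases e1 (x - t) with ⟨a', b', c'⟩ | ⟨a', b', c'⟩ <;>
      rw [b, c, b', c'] <;> split_ifs with hx <;> rw [abs_le] <;> constructor <;> nlinarith
  · rw [if_neg hc, mul_zero]
    push Not at hc
    refine le_of_eq (abs_eq_zero.2 ?_)
    rcases lt_or_ge t x with hx | hx
    · have : s < x := by
        rw [abs_of_pos (by linarith : 0 < x - t)] at hc
        linarith [le_abs_self (s - t)]
      rw [if_neg (by linarith), max_eq_left (by linarith : 0 ≤ x - s),
        max_eq_left (by linarith : 0 ≤ x - t), max_eq_right (by linarith : -(x - s) ≤ 0),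
        max_eq_right (by linarith : -(x - t) ≤ 0)]
      ring
    · have : x < s := by
        rw [abs_of_nonpos (by linarith : x - t ≤ 0)] at hc
        linarith [neg_abs_le (s - t)]
      rw [if_pos hx, max_eq_right (by linarith : x - s ≤ 0),
        max_eq_right (by linarith : x - t ≤ 0), max_eq_left (by linarith : 0 ≤ -(x - s)),
        max_eq_left (by linarith : 0 ≤ -(x - t))]
      ring

theorem score_sub_score_le {β : ℝ} (h0 : 0 ≤ β) (h1 : β ≤ 1) {s s' : ℝ} (h : s ≤ s') (x : ℝ) :
    score β (x - s) - score β (x - s') ≤ s' - s := by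
  unfold score
  rcases le_total (x - s) 0 with a | a <;> rcases le_total (x - s') 0 with b | b <;>
    simp only [max_eq_left, max_eq_right, a, b, neg_nonneg, neg_nonpos] <;> nlinarith

/-- The slopes of the score are β and 1-β, and c bounds both from below. This gives existence,
ordering and consistency of expectiles. -/
theorem le_score_sub_score {β c : ℝ} (h0 : c ≤ β) (h1 : c ≤ 1 - β) {s s' : ℝ} (h : s ≤ s')
    (x : ℝ) : c * (s' - s) ≤ score β (x - s) - score β (x - s') := by
  unfold score
  rcases le_total (x - s) 0 with a | a <;> rcases le_total (x - s') 0 with b | b <;>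
    simp only [max_eq_left, max_eq_right, a, b, neg_nonneg, neg_nonpos] <;> nlinarith

theorem integrable_map_id {Ω : Type*} [MeasurableSpace Ω] {P : Measure Ω} {φ : Ω → ℝ}
    (hφ : AEMeasurable φ P) : Integrable (fun x => x) (P.map φ) ↔ Integrable φ P :=
  integrable_map_measure aestronglyMeasurable_id hφ

theorem integral_map_id {Ω : Type*} [MeasurableSpace Ω] {P : Measure Ω} {φ : Ω → ℝ}
    (hφ : AEMeasurable φ P) : ∫ x, x ∂(P.map φ) = ∫ ω, φ ω ∂P :=
  integral_map hφ aestronglyMeasurable_id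

/-! ### Expectiles as zeros of the mean score. -/

section Law

variable {ν : Measure ℝ} [IsProbabilityMeasure ν]

theorem integrable_posPart (hν : Integrable (fun x => x) ν) (s : ℝ) :
    Integrable (fun x => max (x - s) 0) ν := (hν.sub (integrable_const s)).pos_part

theorem integrable_negPart (hν : Integrable (fun x => x) ν) (s : ℝ) :
    Integrable (fun x => max (-(x - s)) 0) ν := (hν.sub (integrable_const s)).neg_part

theorem integrable_abs_sub (hν : Integrable (fun x => x) ν) (s : ℝ) :
    Integrable (fun x => |x - s|) ν := (hν.sub (integrable_const s)).abs

theorem integrable_score (hν : Integrable (fun x => x) ν) (β s : ℝ) :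
    Integrable (fun x => score β (x - s)) ν :=
  ((integrable_posPart hν s).const_mul _).sub ((integrable_negPart hν s).const_mul _)

theorem integral_score (hν : Integrable (fun x => x) ν) (β s : ℝ) :
    ∫ x, score β (x - s) ∂ν
      = (1 - β) * ∫ x, max (x - s) 0 ∂ν - β * ∫ x, max (-(x - s)) 0 ∂ν := by
  unfold score
  rw [integral_sub ((integrable_posPart hν s).const_mul _) ((integrable_negPart hν s).const_mul _),
    integral_const_mul, integral_const_mul]

theorem integral_posPart_sub_negPart (hν : Integrable (fun x => x) ν) (s : ℝ) :
    ∫ x, max (x - s) 0 ∂ν - ∫ x, max (-(x - s)) 0 ∂ν = ∫ x, x ∂ν - s := by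
  rw [← integral_sub (integrable_posPart hν s) (integrable_negPart hν s)]
  have : ∀ x : ℝ, max (x - s) 0 - max (-(x - s)) 0 = x - s := fun x => by
    rcases le_total 0 (x - s) with h | h
    · rw [max_eq_left h, max_eq_right (by linarith)]; ring
    · rw [max_eq_right h, max_eq_left (by linarith)]; ring
  simp_rw [this]
  rw [integral_sub hν (integrable_const s)]; simp

theorem integral_posPart_add_negPart (hν : Integrable (fun x => x) ν) (s : ℝ) :
    ∫ x, max (x - s) 0 ∂ν + ∫ x, max (-(x - s)) 0 ∂ν = ∫ x, |x - s| ∂ν := by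
  rw [← integral_add (integrable_posPart hν s) (integrable_negPart hν s)]
  congr 1; ext x
  rcases le_total 0 (x - s) with h | h
  · rw [max_eq_left h, max_eq_right (by linarith), abs_of_nonneg h]; ring
  · rw [max_eq_right h, max_eq_left (by linarith), abs_of_nonpos h]; ring

theorem integral_score_sub_le (hν : Integrable (fun x => x) ν) {β : ℝ} (h0 : 0 ≤ β) (h1 : β ≤ 1)
    {s s' : ℝ} (h : s ≤ s') :
    ∫ x, score β (x - s) ∂ν - ∫ x, score β (x - s') ∂ν ≤ s' - s := by
  rw [← integral_sub (integrable_score hν β s) (integrable_score hν β s')]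
  refine (integral_mono ((integrable_score hν β s).sub (integrable_score hν β s'))
    (integrable_const (s' - s)) fun x => score_sub_score_le h0 h1 h x).trans (by simp)

theorem le_integral_score_sub (hν : Integrable (fun x => x) ν) {β c : ℝ} (h0 : c ≤ β)
    (h1 : c ≤ 1 - β) {s s' : ℝ} (h : s ≤ s') :
    c * (s' - s) ≤ ∫ x, score β (x - s) ∂ν - ∫ x, score β (x - s') ∂ν := by
  rw [← integral_sub (integrable_score hν β s) (integrable_score hν β s')]
  refine le_trans (by simp) (integral_mono (integrable_const (c * (s' - s)))
    ((integrable_score hν β s).sub (integrable_score hν β s'))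
    fun x => le_score_sub_score h0 h1 h x)

theorem mul_abs_sub_le_integral_score (hν : Integrable (fun x => x) ν) {β c : ℝ} (h0 : c ≤ β)
    (h1 : c ≤ 1 - β) (s s' : ℝ) :
    c * |s - s'| ≤ |∫ x, score β (x - s) ∂ν - ∫ x, score β (x - s') ∂ν| := by
  rcases le_total s s' with h | h
  · rw [abs_of_nonpos (by linarith : s - s' ≤ 0)]
    have := le_integral_score_sub hν h0 h1 h
    exact le_trans (by linarith) (le_abs_self _)
  · rw [abs_of_nonneg (by linarith : 0 ≤ s - s')]
    have := le_integral_score_sub hν h0 h1 h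
    exact le_trans (by linarith) (neg_le_abs _)

theorem continuous_integral_score (hν : Integrable (fun x => x) ν) {β : ℝ} (h0 : 0 ≤ β)
    (h1 : β ≤ 1) : Continuous fun s => ∫ x, score β (x - s) ∂ν := by
  refine (LipschitzWith.of_dist_le_mul (K := 1) fun s s' => ?_).continuous
  rw [Real.dist_eq, Real.dist_eq, NNReal.coe_one, one_mul]
  rcases le_total s s' with h | h
  · have a := integral_score_sub_le hν h0 h1 h
    have b := le_integral_score_sub hν h0 (by linarith) h
    rw [abs_of_nonneg (by linarith), abs_of_nonpos (by linarith)]; linarith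
  · have a := integral_score_sub_le hν h0 h1 h
    have b := le_integral_score_sub hν h0 (by linarith) h
    rw [abs_of_nonpos (by linarith), abs_of_nonneg (by linarith)]; linarith

/-- With v the mean score at s = 0 and c the lower slope bound, moving the threshold by |v|/c either
way is enough to reach each sign; the intermediate value theorem applies. -/
theorem exists_integral_score_eq_zero (hν : Integrable (fun x => x) ν) {β : ℝ}
    (hβ : β ∈ Set.Ioo (0 : ℝ) 1) : ∃ s, ∫ x, score β (x - s) ∂ν = 0 := by
  set c := min β (1 - β)
  have hc : 0 < c := lt_min hβ.1 (by linarith [hβ.2])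
  set v := ∫ x, score β (x - 0) ∂ν
  have hb : 0 ≤ |v| / c := by positivity
  have e : c * (|v| / c) = |v| := by field_simp
  have a1 := le_integral_score_sub hν (min_le_left β (1 - β)) (min_le_right _ _) hb
  have a2 := le_integral_score_sub hν (min_le_left β (1 - β)) (min_le_right _ _)
    (neg_nonpos.2 hb)
  rw [sub_zero, e] at a1
  rw [sub_neg_eq_add, zero_add, e] at a2
  obtain ⟨s, -, hs⟩ := intermediate_value_Icc' (a := -(|v| / c)) (b := |v| / c) (by linarith)
    (continuous_integral_score hν hβ.1.le hβ.2.le).continuousOn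
    (show (0 : ℝ) ∈ _ from ⟨by linarith [le_abs_self v], by linarith [neg_abs_le v]⟩)
  exact ⟨s, hs⟩

/-- `expectile` is a choice by `epsilon`, so its defining equation becomes available only through
existence of a zero. -/
theorem integral_score_expectile (hν : Integrable (fun x => x) ν) {β : ℝ}
    (hβ : β ∈ Set.Ioo (0 : ℝ) 1) : ∫ x, score β (x - expectile β ν) ∂ν = 0 := by
  obtain ⟨s, hs⟩ := exists_integral_score_eq_zero hν hβ
  have := Classical.epsilon_spec (p := fun t : ℝ =>
    (1 - β) * ∫ x, max (x - t) 0 ∂ν = β * ∫ x, max (-(x - t)) 0 ∂ν)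
    ⟨s, by rw [integral_score hν] at hs; linarith⟩
  rw [integral_score hν]
  exact sub_eq_zero.2 this

theorem expectile_le_iff (hν : Integrable (fun x => x) ν) {β : ℝ} (hβ : β ∈ Set.Ioo (0 : ℝ) 1)
    (s : ℝ) : expectile β ν ≤ s ↔ ∫ x, score β (x - s) ∂ν ≤ 0 := by
  have h := integral_score_expectile hν hβ
  have hc : 0 < min β (1 - β) := lt_min hβ.1 (by linarith [hβ.2])
  constructor
  · intro hs
    have := le_integral_score_sub hν (min_le_left β (1 - β)) (min_le_right _ _) hs
    nlinarith
  · intro hs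
    by_contra! hlt
    have := le_integral_score_sub hν (min_le_left β (1 - β)) (min_le_right _ _) hlt.le
    nlinarith [mul_pos hc (sub_pos.2 hlt)]

/-- For β < 1/2 the balance (1-β)E₊ = βE₋ forces E₊ ≤ E₋, and E₊ - E₋ is the mean minus the
expectile. -/
theorem integral_le_expectile (hν : Integrable (fun x => x) ν) {β : ℝ}
    (hβ : β ∈ Set.Ioo (0 : ℝ) (1 / 2)) : ∫ x, x ∂ν ≤ expectile β ν := by
  have h := integral_score_expectile hν (β := β) ⟨hβ.1, by linarith [hβ.2]⟩
  rw [integral_score hν] at h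
  have h2 := integral_posPart_sub_negPart hν (expectile β ν)
  have h3 : 0 ≤ ∫ x, max (x - expectile β ν) 0 ∂ν := integral_nonneg fun x => le_max_right _ _
  have h4 : 0 ≤ ∫ x, max (-(x - expectile β ν)) 0 ∂ν := integral_nonneg fun x => le_max_right _ _
  have := hβ.1; have := hβ.2
  nlinarith

end Law

/-! ### The diversification quotient as a ratio of moments. -/

/-- Since q < 1, the convention for inf ∅ never comes into play; for q = 0 the infimum is not
attained. -/
theorem csInf_Ioo_inter_Ici {q : ℝ} (h0 : 0 ≤ q) (h1 : q < 1) :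
    (Set.Ioo (0 : ℝ) 1 ∩ Set.Ici q).Nonempty ∧ sInf (Set.Ioo (0 : ℝ) 1 ∩ Set.Ici q) = q := by
  rcases h0.eq_or_lt with rfl | h
  · have : Set.Ioo (0 : ℝ) 1 ∩ Set.Ici 0 = Set.Ioo 0 1 :=
      Set.inter_eq_left.2 fun x hx => hx.1.le
    rw [this]
    exact ⟨Set.nonempty_Ioo.2 one_pos, csInf_Ioo one_pos⟩
  · have : Set.Ioo (0 : ℝ) 1 ∩ Set.Ici q = Set.Ico q 1 := by
      ext x
      exact ⟨fun hx => ⟨hx.2, hx.1.2⟩, fun hx => ⟨⟨h.trans_le hx.1, hx.2⟩, hx.1⟩⟩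
    rw [this]
    exact ⟨Set.nonempty_Ico.2 h1, csInf_Ico h1⟩

/-- For `α < 1 / 2`, the positive part carries at most half of the mean absolute deviation of the
sum from the sum of the expectiles. -/
theorem two_mul_integral_posPart_le {n : ℕ} {μ : Measure (Fin n → ℝ)} [IsProbabilityMeasure μ]
    (hμ : ∀ i, Integrable (fun x => x i) μ) {α : ℝ} (hα : α ∈ Set.Ioo (0 : ℝ) (1 / 2)) {t : ℝ}
    (ht : t = ∑ i, expectile α (μ.map fun x => x i)) :
    2 * ∫ x, max ((∑ i, x i) - t) 0 ∂μ ≤ ∫ x, |(∑ i, x i) - t| ∂μ := by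
  have hS : Measurable fun x : Fin n → ℝ => ∑ i, x i := by fun_prop
  have hSi : Integrable (fun x => x) (μ.map fun x => ∑ i, x i) :=
    (integrable_map_id hS.aemeasurable).2 (integrable_finsetSum _ fun i _ => hμ i)
  have : IsProbabilityMeasure (μ.map fun x => ∑ i, x i) :=
    Measure.isProbabilityMeasure_map hS.aemeasurable
  have h1 := integral_posPart_sub_negPart hSi t
  have h2 := integral_posPart_add_negPart hSi t
  -- The condition α < 1/2 enters here: every mean is below its expectile, so E S ≤ t.
  have h3 : ∫ x, x ∂(μ.map fun x => ∑ i, x i) ≤ t := by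
    rw [integral_map_id hS.aemeasurable,
      integral_finsetSum _ fun i _ => hμ i, ht]
    refine Finset.sum_le_sum fun i _ => ?_
    have hi : Measurable fun x : Fin n → ℝ => x i := by fun_prop
    have : IsProbabilityMeasure (μ.map fun x => x i) :=
      Measure.isProbabilityMeasure_map hi.aemeasurable
    have := integral_le_expectile (ν := μ.map fun x => x i)
      ((integrable_map_id hi.aemeasurable).2 (hμ i)) hα
    rwa [integral_map_id hi.aemeasurable] at this
  have h4 := integral_map (μ := μ) hS.aemeasurable (f := fun x => |x - t|) (by fun_prop)
  have h5 := integral_map (μ := μ) hS.aemeasurable (f := fun x => max (x - t) 0) (by fun_prop)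
  linarith

/-- The expectile-based diversification quotient as a ratio of two moments. -/
theorem dqEx_eq {n : ℕ} {μ : Measure (Fin n → ℝ)} [IsProbabilityMeasure μ]
    (hμ : ∀ i, Integrable (fun x => x i) μ) {α : ℝ} (hα : α ∈ Set.Ioo (0 : ℝ) (1 / 2)) {t : ℝ}
    (ht : t = ∑ i, expectile α (μ.map fun x => x i)) :
    dqEx α μ = 1 / α *
      ((∫ x, max ((∑ i, x i) - t) 0 ∂μ) / ∫ x, |(∑ i, x i) - t| ∂μ) := by
  have hS : Measurable fun x : Fin n → ℝ => ∑ i, x i := by fun_prop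
  have hSi : Integrable (fun x => x) (μ.map fun x => ∑ i, x i) :=
    (integrable_map_id hS.aemeasurable).2 (integrable_finsetSum _ fun i _ => hμ i)
  have : IsProbabilityMeasure (μ.map fun x => ∑ i, x i) :=
    Measure.isProbabilityMeasure_map hS.aemeasurable
  have hle := two_mul_integral_posPart_le hμ hα ht
  have hp0 : 0 ≤ ∫ x, max ((∑ i, x i) - t) 0 ∂μ := integral_nonneg fun x => le_max_right _ _
  have hmem : ∀ β ∈ Set.Ioo (0 : ℝ) 1, (expectile β (μ.map fun x => ∑ i, x i) ≤ t ↔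
      ∫ x, max ((∑ i, x i) - t) 0 ∂μ ≤ β * ∫ x, |(∑ i, x i) - t| ∂μ) := by
    intro β hβ
    rw [expectile_le_iff hSi hβ]
    simp_rw [score_eq]
    rw [integral_sub (integrable_posPart hSi t) ((integrable_abs_sub hSi t).const_mul _),
      integral_const_mul, integral_map hS.aemeasurable (by fun_prop),
      integral_map hS.aemeasurable (by fun_prop), sub_nonpos]
  set p := ∫ x, max ((∑ i, x i) - t) 0 ∂μ
  set b := ∫ x, |(∑ i, x i) - t| ∂μ
  have hb0 : 0 ≤ b := by linarith
  have key : {β | β ∈ Set.Ioo 0 1 ∧ expectile β (μ.map fun x => ∑ i, x i) ≤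
      ∑ i, expectile α (μ.map fun x => x i)} = Set.Ioo 0 1 ∩ Set.Ici (p / b) := by
    ext β
    simp only [Set.mem_ofPred_eq, Set.mem_inter_iff, Set.mem_Ici]
    refine and_congr_right fun hβ => ?_
    rw [← ht, hmem β hβ]
    -- If b = 0, then p ≤ 0 by `hle` and every level is admissible, in agreement with `p / 0 = 0`.
    rcases hb0.eq_or_lt with h | h
    · rw [← h, div_zero, mul_zero]
      exact ⟨fun _ => hβ.1.le, fun _ => by linarith⟩
    · rw [div_le_iff₀ h]
  have hq := csInf_Ioo_inter_Ici (q := p / b) (div_nonneg hp0 hb0) (by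
    rcases hb0.eq_or_lt with h | h
    · rw [← h, div_zero]; exact one_pos
    · rw [div_lt_one h]; linarith)
  have hne := key ▸ hq.1
  unfold dqEx diversificationQuotient
  dsimp only
  rw [if_pos hne, key, hq.2]
  ring

/-! ### Empirical laws. -/

section Empirical

variable {E : Type*} [MeasurableSpace E]

instance isProbabilityMeasure_empiricalLaw (N : ℕ) [NeZero N] (x : ℕ → E) :
    IsProbabilityMeasure (empiricalLaw N x) := by
  constructor
  simp [empiricalLaw, ENNReal.inv_mul_cancel (Nat.cast_ne_zero.2 (NeZero.ne N))
    (ENNReal.natCast_ne_top N)]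

theorem integrable_empiricalLaw [MeasurableSingletonClass E] {N : ℕ} (hN : 0 < N) (x : ℕ → E)
    (f : E → ℝ) : Integrable f (empiricalLaw N x) := by
  refine Integrable.smul_measure ?_ (by simp [hN.ne'])
  exact integrable_finsetSum_measure.2 fun i _ => integrable_dirac (by simp)

theorem integral_empiricalLaw [MeasurableSingletonClass E] (N : ℕ) (x : ℕ → E)
    (f : E → ℝ) : ∫ z, f z ∂(empiricalLaw N x) = (∑ k ∈ Finset.range N, f (x k)) / N := by
  rw [empiricalLaw, integral_smul_measure,
    integral_finsetSum_measure fun i _ => integrable_dirac (by simp)]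
  simp [div_eq_inv_mul]

theorem map_empiricalLaw {F : Type*} [MeasurableSpace F] (N : ℕ) (x : ℕ → E) {g : E → F}
    (hg : Measurable g) : (empiricalLaw N x).map g = empiricalLaw N fun k => g (x k) := by
  rw [empiricalLaw, Measure.map_smul, ← Measure.mapₗ_apply_of_measurable hg, map_sum]
  simp [empiricalLaw, Measure.mapₗ_apply_of_measurable hg, Measure.map_dirac' hg]

end Empirical

theorem dqExEstimator_eq_dqEx {n N : ℕ} (hN : 0 < N) {α : ℝ} (hα : α ∈ Set.Ioo (0 : ℝ) (1 / 2))
    (x : ℕ → Fin n → ℝ) : dqExEstimator α N x = dqEx α (empiricalLaw N x) := by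
  have : NeZero N := ⟨hN.ne'⟩
  rw [dqEx_eq (fun i => integrable_empiricalLaw hN x _) hα rfl]
  simp_rw [integral_empiricalLaw]
  have : ∀ i, (empiricalLaw N x).map (fun z => z i) = empiricalLaw N fun k => x k i :=
    fun i => map_empiricalLaw N x (by fun_prop)
  simp_rw [this]
  unfold dqExEstimator
  rw [div_div_div_cancel_right₀ (by positivity)]

/-! ### The function F̃, its generalized inverse and its derivative. -/

section TildeF

variable {ν : Measure ℝ} [IsProbabilityMeasure ν]

theorem mul_cdf_sub_setIntegral (hν : Integrable (fun x => x) ν) (y : ℝ) :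
    y * cdf ν y - ∫ x in Set.Iic y, x ∂ν = ∫ x, max (-(x - y)) 0 ∂ν := by
  have h1 : y * cdf ν y = ∫ x in Set.Iic y, y ∂ν := by
    rw [setIntegral_const, cdf_eq_real, smul_eq_mul, mul_comm]
  rw [h1, ← integral_sub (integrable_const y) hν.integrableOn,
    ← integral_indicator measurableSet_Iic]
  congr 1; ext x
  by_cases hx : x ≤ y
  · rw [Set.indicator_of_mem (by exact hx), max_eq_left (by linarith)]; ring
  · rw [Set.indicator_of_notMem (by exact hx), max_eq_right (by linarith)]

theorem tildeF_eq (hν : Integrable (fun x => x) ν) (y : ℝ) :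
    tildeF ν y = (∫ x, max (-(x - y)) 0 ∂ν) /
      (2 * (∫ x, max (-(x - y)) 0 ∂ν) + (∫ x, x ∂ν) - y) := by
  rw [tildeF, mul_cdf_sub_setIntegral hν]

/-- So F̃(y) = E(X-y)₋ / E|X-y|; likewise each D_i is E|X_i - y_i|. -/
theorem two_mul_negPart_add (hν : Integrable (fun x => x) ν) (y : ℝ) :
    2 * (∫ x, max (-(x - y)) 0 ∂ν) + (∫ x, x ∂ν) - y = ∫ x, |x - y| ∂ν := by
  linarith [integral_posPart_sub_negPart hν y, integral_posPart_add_negPart hν y]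

theorem le_tildeF_iff (hν : Integrable (fun x => x) ν) {α y : ℝ}
    (hy : 0 < ∫ x, |x - y| ∂ν) :
    1 - α ≤ tildeF ν y ↔ ∫ x, score α (x - y) ∂ν ≤ 0 := by
  rw [tildeF_eq hν, two_mul_negPart_add hν, le_div_iff₀ hy, integral_score hν,
    ← integral_posPart_add_negPart hν]
  constructor <;> intro h <;> linarith

/-- The generalized inverse of `F̃` at `1 - α` is the expectile at level `α`. -/
theorem genInverse_tildeF (hν : Integrable (fun x => x) ν) {α : ℝ}
    (hα : α ∈ Set.Ioo (0 : ℝ) 1) : genInverse (tildeF ν) (1 - α) = expectile α ν := by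
  have h0 : ∀ y, 0 ≤ ∫ x, |x - y| ∂ν := fun y => integral_nonneg fun x => abs_nonneg _
  have hlow : ∀ y ∈ {y | 1 - α ≤ tildeF ν y}, expectile α ν ≤ y := by
    intro y hy
    have hpos : 0 < ∫ x, |x - y| ∂ν := by
      refine (h0 y).lt_of_ne' fun h => ?_
      have : 1 - α ≤ tildeF ν y := hy
      rw [tildeF_eq hν, two_mul_negPart_add hν, h, div_zero] at this
      linarith [hα.2]
    exact (expectile_le_iff hν hα y).2 ((le_tildeF_iff hν hpos).1 hy)
  have hup : ∀ y, expectile α ν < y → y ∈ {y | 1 - α ≤ tildeF ν y} := by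
    intro y hy
    have hneg : ∫ x, score α (x - y) ∂ν < 0 := by
      have h := integral_score_expectile hν hα
      have := le_integral_score_sub hν (min_le_left α (1 - α)) (min_le_right _ _) hy.le
      have hc : 0 < min α (1 - α) := lt_min hα.1 (by linarith [hα.2])
      nlinarith [mul_pos hc (sub_pos.2 hy)]
    have hpos : 0 < ∫ x, |x - y| ∂ν := by
      refine (h0 y).lt_of_ne' fun h => hneg.ne ?_
      refine integral_eq_zero_of_ae ?_
      filter_upwards [(integral_eq_zero_iff_of_nonneg (fun x => abs_nonneg (x - y))
        (integrable_abs_sub hν y)).1 h] with x hx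
      have : x - y = 0 := abs_eq_zero.1 hx
      simp [this, score]
    exact (le_tildeF_iff hν hpos).2 hneg.le
  -- The expectile itself may fail to lie in the set: for a point mass F̃ is 0/0 = 0 there. Only
  -- points strictly above it are used.
  refine le_antisymm (le_of_forall_gt fun y hy => ?_)
    (le_csInf ⟨_, hup _ (lt_add_one _)⟩ hlow)
  obtain ⟨z, hz, hzy⟩ := exists_between hy
  exact (csInf_le ⟨_, hlow⟩ (hup z hz)).trans_lt hzy

theorem integral_abs_sub_pos (hν : Integrable (fun x => x) ν) {y : ℝ} (hy : ν {y} = 0) :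
    0 < ∫ x, |x - y| ∂ν := by
  refine (integral_nonneg fun x => abs_nonneg _).lt_of_ne' fun h => ?_
  have h1 := (integral_eq_zero_iff_of_nonneg (fun x => abs_nonneg (x - y))
        (integrable_abs_sub hν y)).1 h
  have h2 : ∀ᵐ x ∂ν, x ≠ y := by
    rw [ae_iff]; simpa using hy
  obtain ⟨x, hx, hx'⟩ := (h1.and h2).exists
  exact hx' (sub_eq_zero.1 (abs_eq_zero.1 hx))

/-- The integrand is 1-Lipschitz in s and has its kink at s = x, so it is differentiable at y for
almost every x when y is not an atom. -/
theorem hasDerivAt_integral_negPart (hν : Integrable (fun x => x) ν) {y : ℝ} (hy : ν {y} = 0) :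
    HasDerivAt (fun s => ∫ x, max (-(x - s)) 0 ∂ν) (cdf ν y) y := by
  have h2 : ∀ᵐ x ∂ν, x ≠ y := by
    rw [ae_iff]; simpa using hy
  have := (hasDerivAt_integral_of_dominated_loc_of_lip (μ := ν) (x₀ := y) (s := Set.univ)
    (F := fun s x => max (-(x - s)) 0) (F' := (Set.Iic y).indicator 1) (bound := fun _ => 1)
    univ_mem (Eventually.of_forall fun s => by fun_prop) (integrable_negPart hν y)
    ((measurable_one.indicator measurableSet_Iic).aestronglyMeasurable)
    (Eventually.of_forall fun x => ?_) (integrable_const _) ?_).2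
  · rwa [integral_indicator_one measurableSet_Iic, ← cdf_eq_real] at this
  · refine LipschitzOnWith.of_dist_le_mul fun s _ s' _ => ?_
    simp only [Real.dist_eq]
    refine (abs_max_sub_max_le_abs _ _ _).trans (le_of_eq ?_)
    rw [show -(x - s) - -(x - s') = s - s' by ring]
    simp
  · filter_upwards [h2] with x hx
    rcases lt_or_gt_of_ne hx with h | h
    · rw [Set.indicator_of_mem (by exact h.le)]
      have h3 : HasDerivAt (fun s => -(x - s)) 1 y :=
        ((hasDerivAt_id y).const_sub x).fun_neg.congr_deriv (neg_neg 1)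
      refine h3.congr_of_eventuallyEq ?_
      filter_upwards [lt_mem_nhds h] with s hs
      exact max_eq_left (by linarith)
    · rw [Set.indicator_of_notMem (by simpa using h)]
      refine (hasDerivAt_const y (0 : ℝ)).congr_of_eventuallyEq ?_
      filter_upwards [gt_mem_nhds h] with s hs
      exact max_eq_right (by linarith)

/-- Derivative of `F̃` at the expectile, when the latter is not an atom. -/
theorem hasDerivAt_tildeF (hν : Integrable (fun x => x) ν) {α : ℝ}
    (hα : α ∈ Set.Ioo (0 : ℝ) 1) {y : ℝ} (hy : y = expectile α ν) (hat : ν {y} = 0) :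
    HasDerivAt (tildeF ν)
      ((1 - α + (2 * α - 1) * cdf ν y) / ∫ x, |x - y| ∂ν) y := by
  have hm := hasDerivAt_integral_negPart hν hat
  have hpos := integral_abs_sub_pos hν hat
  have hD : HasDerivAt (fun s => 2 * (∫ x, max (-(x - s)) 0 ∂ν) + (∫ x, x ∂ν) - s)
      (2 * cdf ν y - 1) y := ((hm.const_mul 2).add_const _).sub (hasDerivAt_id y)
  have h := hm.div hD (by rw [two_mul_negPart_add hν]; exact hpos.ne')
  have e : tildeF ν = fun s => (∫ x, max (-(x - s)) 0 ∂ν) /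
      (2 * (∫ x, max (-(x - s)) 0 ∂ν) + (∫ x, x ∂ν) - s) := funext fun s => tildeF_eq hν s
  rw [e]
  refine h.congr_deriv ?_
  rw [two_mul_negPart_add hν]
  have h0 := integral_score_expectile hν hα
  rw [← hy, integral_score hν] at h0
  have h1 := integral_posPart_add_negPart hν y
  -- The expectile equation ties the numerator of F̃ to its denominator and collapses the quotient
  -- rule to a single division.
  have h2 : ∫ x, max (-(x - y)) 0 ∂ν = (1 - α) * ∫ x, |x - y| ∂ν := by
    rw [← h1]; linarith
  rw [h2]
  field_simp
  ring

end TildeF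

/-! ### Difference quotients of sample means of scores. -/

/-- Difference quotient `(Φ(s) - Φ(t)) / (s - t)` of a function, with the value `d` for `s = t`. -/
def slopeOr (Φ : ℝ → ℝ) (d s t : ℝ) : ℝ := if s = t then d else (Φ s - Φ t) / (s - t)

/-- Holds for any d. Later d is the expected limit, so that thresholds equal to t do not disturb
convergence. -/
theorem sub_mul_slopeOr (Φ : ℝ → ℝ) (d s t : ℝ) :
    (s - t) * slopeOr Φ d s t = Φ s - Φ t := by
  unfold slopeOr
  split_ifs with h
  · simp [h]
  · have : s - t ≠ 0 := sub_ne_zero.2 h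
    field_simp

/-- The mean of `f` over the first `N` data points. -/
def sampleMean {E : Type*} (x : ℕ → E) (N : ℕ) (f : E → ℝ) : ℝ :=
  (∑ k ∈ Finset.range N, f (x k)) / N

theorem sampleMean_sub {E : Type*} (x : ℕ → E) (N : ℕ) (f g : E → ℝ) :
    sampleMean x N (fun z => f z - g z) = sampleMean x N f - sampleMean x N g := by
  simp [sampleMean, Finset.sum_sub_distrib, sub_div]

theorem sampleMean_const_mul {E : Type*} (x : ℕ → E) (N : ℕ) (c : ℝ) (f : E → ℝ) :
    sampleMean x N (fun z => c * f z) = c * sampleMean x N f := by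
  simp [sampleMean, ← Finset.mul_sum, mul_div_assoc]

theorem sampleMean_mono {E : Type*} (x : ℕ → E) (N : ℕ) {f g : E → ℝ} (h : ∀ z, f z ≤ g z) :
    sampleMean x N f ≤ sampleMean x N g :=
  div_le_div_of_nonneg_right (Finset.sum_le_sum fun k _ => h (x k)) (Nat.cast_nonneg N)

theorem abs_sampleMean_le {E : Type*} (x : ℕ → E) (N : ℕ) (f : E → ℝ) :
    |sampleMean x N f| ≤ sampleMean x N fun z => |f z| := by
  rw [sampleMean, abs_div, Nat.abs_cast]
  exact div_le_div_of_nonneg_right (Finset.abs_sum_le_sum_abs _ _) (Nat.cast_nonneg N)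

theorem sampleMean_const {E : Type*} (x : ℕ → E) {N : ℕ} (hN : 0 < N) (c : ℝ) :
    sampleMean x N (fun _ => c) = c := by
  have : (N : ℝ) ≠ 0 := by positivity
  simp [sampleMean]; field_simp

/-- Difference quotients of the empirical score along thresholds converging to a point `t` at
which the distribution function is continuous. -/
theorem tendsto_slopeOr_sampleMean_score {E : Type*} {x : ℕ → E} {f : E → ℝ} {s : ℕ → ℝ}
    {t β G : ℝ} {p : ℕ → ℝ} (h0 : 0 ≤ β) (h1 : β ≤ 1) (hs : Tendsto s atTop (𝓝 t))
    (hG : Tendsto (fun N => sampleMean x N fun z => if f z ≤ t then 1 else 0) atTop (𝓝 G))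
    (hp : ∀ m : ℕ, Tendsto (fun N => sampleMean x N fun z =>
      if |f z - t| ≤ 1 / ((m : ℝ) + 1) then 1 else 0) atTop (𝓝 (p m)))
    (hp0 : Tendsto p atTop (𝓝 0)) :
    Tendsto (fun N => slopeOr (fun r => sampleMean x N fun z => score β (f z - r))
      (-(1 - β + (2 * β - 1) * G)) (s N) t) atTop (𝓝 (-(1 - β + (2 * β - 1) * G))) := by
  -- The sample mean of the linearized slopes at t, which does not involve the moving threshold.
  set c : ℕ → ℝ := fun N => sampleMean x N fun z =>
    -(1 - β + (2 * β - 1) * (if f z ≤ t then 1 else 0))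
  have hc : Tendsto c atTop (𝓝 (-(1 - β + (2 * β - 1) * G))) := by
    refine Tendsto.congr' ?_ ((tendsto_const_nhds.add (hG.const_mul _)).neg)
    filter_upwards [eventually_gt_atTop 0] with N hN
    have : ∀ z, -(1 - β + (2 * β - 1) * (if f z ≤ t then 1 else 0))
      = -(1 - β) - (2 * β - 1) * (if f z ≤ t then 1 else 0) := fun z => by ring
    simp only [c]
    simp_rw [this]
    rw [sampleMean_sub, sampleMean_const_mul, sampleMean_const x hN]
    ring
  rw [Metric.tendsto_atTop] at hs ⊢
  intro ε hε
  -- A fixed window of radius 1/(m+1) with limiting mass below ε/2 eventually contains the moving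
  -- window of radius |s N - t|.
  obtain ⟨m, hm⟩ := ((tendsto_order.1 hp0).2 (ε / 2) (by positivity)).exists
  obtain ⟨N1, hN1⟩ := eventually_atTop.1 ((tendsto_order.1 (hp m)).2 _ hm)
  obtain ⟨N2, hN2⟩ := hs (1 / ((m : ℝ) + 1)) (by positivity)
  obtain ⟨N3, hN3⟩ := Metric.tendsto_atTop.1 hc (ε / 2) (by positivity)
  refine ⟨max N1 (max N2 N3), fun N hN => ?_⟩
  have a1 := hN1 N (by omega)
  have a2 := hN2 N (by omega)
  have a3 := hN3 N (by omega)
  rw [Real.dist_eq] at a2 a3 ⊢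
  by_cases hst : s N = t
  · simpa [slopeOr, hst] using hε
  have hst' : 0 < |s N - t| := abs_pos.2 (sub_ne_zero.2 hst)
  have key : |(sampleMean x N fun z => score β (f z - s N))
      - (sampleMean x N fun z => score β (f z - t))
      - (s N - t) * c N| ≤ |s N - t| * (ε / 2) := by
    simp only [c]
    rw [← sampleMean_const_mul, ← sampleMean_sub, ← sampleMean_sub]
    refine (abs_sampleMean_le _ _ _).trans ?_
    refine (sampleMean_mono x N (g := fun z => |s N - t| *
      (if |f z - t| ≤ 1 / ((m : ℝ) + 1) then 1 else 0)) fun z => ?_).trans ?_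
    · refine (score_increment h0 h1 (f z) (s N) t).trans ?_
      refine mul_le_mul_of_nonneg_left ?_ (abs_nonneg _)
      split_ifs with u v
      · exact le_rfl
      · exact absurd (u.trans a2.le) v
      · exact zero_le_one
      · exact le_rfl
    · rw [sampleMean_const_mul]
      exact mul_le_mul_of_nonneg_left a1.le (abs_nonneg _)
  have e := sub_mul_slopeOr (fun r => sampleMean x N fun z => score β (f z - r))
    (-(1 - β + (2 * β - 1) * G)) (s N) t
  beta_reduce at e
  rw [← e, ← mul_sub, abs_mul] at key
  have key2 := le_of_mul_le_mul_left key hst'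
  set w := slopeOr (fun r => sampleMean x N fun z => score β (f z - r))
      (-(1 - β + (2 * β - 1) * G)) (s N) t
  have := abs_sub_le w (c N) (-(1 - β + (2 * β - 1) * G))
  linarith

/-! ### Measurability of the empirical quantities. -/

section Measurability

variable {E : Type*} [MeasurableSpace E]

theorem measurable_sampleMean_score (N : ℕ) {f : E → ℝ} (hf : Measurable f) (β : ℝ)
    {r : (ℕ → E) → ℝ} (hr : Measurable r) :
    Measurable fun x : ℕ → E => sampleMean x N fun z => score β (f z - r x) := by
  unfold sampleMean
  exact (Finset.measurable_fun_sum _ fun k _ => (measurable_score β).comp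
    ((hf.comp (measurable_pi_apply k)).sub hr)).div_const _

theorem integral_score_empiricalLaw (N : ℕ) (x : ℕ → ℝ) (β s : ℝ) :
    ∫ z, score β (z - s) ∂(empiricalLaw N x) = sampleMean x N fun z => score β (z - s) :=
  integral_empiricalLaw N x _

theorem measurable_expectile_empiricalLaw {β : ℝ} (hβ : β ∈ Set.Ioo (0 : ℝ) 1) (N : ℕ) :
    Measurable fun x : ℕ → ℝ => expectile β (empiricalLaw N x) := by
  rcases Nat.eq_zero_or_pos N with rfl | hN
  · have : ∀ x : ℕ → ℝ, empiricalLaw 0 x = 0 := fun x => by simp [empiricalLaw]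
    simp_rw [this]
    exact measurable_const
  · have : NeZero N := ⟨hN.ne'⟩
    refine measurable_of_Iic fun s => ?_
    -- Sublevel sets of the expectile are sign conditions on a sample mean, so the choice operator
    -- does no harm.
    have : (fun x : ℕ → ℝ => expectile β (empiricalLaw N x)) ⁻¹' Set.Iic s
        = {x | (sampleMean x N fun z => score β (z - s)) ≤ 0} := by
      ext x
      rw [Set.mem_preimage, Set.mem_Iic, expectile_le_iff (integrable_empiricalLaw hN x _) hβ,
        integral_score_empiricalLaw]
      rfl
    rw [this]
    exact measurableSet_le (measurable_sampleMean_score N measurable_id β measurable_const)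
      measurable_const

theorem measurable_slopeOr {Φ : E → ℝ → ℝ} {s : E → ℝ} (d t : ℝ) (hs : Measurable s)
    (h1 : Measurable fun x => Φ x (s x)) (h2 : Measurable fun x => Φ x t) :
    Measurable fun x => slopeOr (Φ x) d (s x) t := by
  unfold slopeOr
  exact Measurable.ite (measurableSet_eq_fun hs measurable_const) measurable_const
    ((h1.sub h2).div (hs.sub measurable_const))

end Measurability

/-! ### Slutsky-type lemmas. -/

section Convergence

variable {Ω Ω' : Type*} [MeasurableSpace Ω] {P : Measure Ω} [IsProbabilityMeasure P]
  [MeasurableSpace Ω'] {P' : Measure Ω'} [IsProbabilityMeasure P']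

/-- Convergence in distribution to the constant `0` implies convergence in probability. -/
theorem tendstoInMeasure_zero_of_tendstoInDistribution {X : ℕ → Ω → ℝ}
    (h : TendstoInDistribution X atTop (fun _ : Ω' => (0 : ℝ)) (fun _ => P) P') :
    TendstoInMeasure P X atTop (fun _ => 0) := by
  rw [tendstoInMeasure_iff_norm]
  intro ε hε
  have hm : MeasurableSet {x : ℝ | ε ≤ ‖x‖} := measurableSet_le measurable_const measurable_norm
  have hcl : IsClosed {x : ℝ | ε ≤ ‖x‖} := isClosed_le continuous_const continuous_norm
  have hz : (P'.map fun _ => (0 : ℝ)) {x : ℝ | ε ≤ ‖x‖} = 0 := by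
    rw [Measure.map_apply measurable_const hm]
    simp [hε.not_ge]
  have := ProbabilityMeasure.tendsto_measure_of_null_frontier_of_tendsto' h.tendsto
    (E := {x : ℝ | ε ≤ ‖x‖}) (measure_mono_null hcl.frontier_subset hz)
  simp only [ProbabilityMeasure.coe_mk] at this
  rw [hz] at this
  refine this.congr fun N => ?_
  rw [Measure.map_apply_of_aemeasurable (h.forall_aemeasurable N) hm]
  simp

/-- Replacing the deterministic coefficients of a linear combination of sequences that converge in
distribution by random coefficients converging almost surely does not change the limit. -/
theorem tendstoInDistribution_sum_mul {ι : Type*} [Fintype ι] {W c : ι → ℕ → Ω → ℝ} {a : ι → ℝ}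
    {μ : ι → Measure ℝ} [∀ j, IsProbabilityMeasure (μ j)] {Z : Ω' → ℝ} {R : ℕ → Ω → ℝ}
    (hW : ∀ j, TendstoInDistribution (W j) atTop id (fun _ => P) (μ j))
    (hc : ∀ j N, AEMeasurable (c j N) P)
    (hca : ∀ j, ∀ᵐ ω ∂P, Tendsto (fun N => c j N ω) atTop (𝓝 (a j)))
    (hZ : TendstoInDistribution (fun N ω => ∑ j, a j * W j N ω) atTop Z (fun _ => P) P')
    (hR : ∀ N, AEMeasurable (R N) P)
    (hRW : ∀ᵐ ω ∂P, ∀ᶠ N in atTop, R N ω = ∑ j, c j N ω * W j N ω) :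
    TendstoInDistribution R atTop Z (fun _ => P) P' := by
  have hWm : ∀ j N, AEMeasurable (W j N) P := fun j N => (hW j).forall_aemeasurable N
  -- Each correction is a product of a null sequence and a sequence converging in distribution.
  have hterm : ∀ j, TendstoInMeasure P (fun N ω => (c j N ω - a j) * W j N ω) atTop
      (fun _ => 0) := by
    intro j
    have h1 : TendstoInMeasure P (fun N ω => c j N ω - a j) atTop (fun _ => 0) := by
      refine tendstoInMeasure_of_tendsto_ae
        (fun N => ((hc j N).sub_const _).aestronglyMeasurable) ?_
      filter_upwards [hca j] with ω hω
      simpa using hω.sub_const (a j)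
    have h2 := (hW j).continuous_comp_prodMk_of_tendstoInMeasure_const
      (g := fun p : ℝ × ℝ => p.2 * p.1) (by fun_prop) h1 (fun N => (hc j N).sub_const _)
    simp only [zero_mul] at h2
    exact tendstoInMeasure_zero_of_tendstoInDistribution h2
  have hsum : ∀ s : Finset ι, TendstoInDistribution
      (fun N ω => ∑ j, a j * W j N ω + ∑ j ∈ s, (c j N ω - a j) * W j N ω) atTop Z
      (fun _ => P) P' := by
    classical
    intro s
    induction s using Finset.induction_on with
    | empty => simpa using hZ
    | insert i s hi ih =>
      have := ih.add_of_tendstoInMeasure_const (hterm i)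
        (fun N => ((hc i N).sub_const _).mul (hWm i N))
      simp only [add_zero] at this
      refine this.congr (fun N => Eventually.of_forall fun ω => ?_) (ae_eq_refl _)
      beta_reduce
      rw [Pi.add_apply, Finset.sum_insert hi]
      ring
  refine tendstoInDistribution_of_tendstoInMeasure_sub R Z (hsum Finset.univ) ?_ hR
  refine tendstoInMeasure_of_tendsto_ae
    (fun N => ((hR N).sub ((hsum Finset.univ).forall_aemeasurable N)).aestronglyMeasurable) ?_
  filter_upwards [hRW] with ω hω
  refine tendsto_const_nhds.congr' ?_
  filter_upwards [hω] with N hN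
  simp only [Pi.sub_apply, Pi.zero_apply, hN, ← Finset.sum_add_distrib]
  rw [eq_comm, sub_eq_zero]
  exact Finset.sum_congr rfl fun j _ => by ring

end Convergence

/-! ### Limit theorems for i.i.d. samples. -/

section Sampling

variable {Ω E : Type*} [MeasurableSpace Ω] {P : Measure Ω} [MeasurableSpace E] {X : Ω → E}
  {Xs : ℕ → Ω → E}

theorem identDistrib_comp (h_ident : ∀ k, IdentDistrib (Xs k) X P P) {f : E → ℝ}
    (hf : Measurable f) (i j : ℕ) :
    IdentDistrib (fun ω => f (Xs i ω)) (fun ω => f (Xs j ω)) P P :=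
  ((h_ident i).trans (h_ident j).symm).comp hf

theorem tendsto_sampleMean (h_indep : iIndepFun Xs P)
    (h_ident : ∀ k, IdentDistrib (Xs k) X P P) {f : E → ℝ} (hf : Measurable f)
    (hint : Integrable (fun ω => f (X ω)) P) :
    ∀ᵐ ω ∂P, Tendsto (fun N => sampleMean (fun k => Xs k ω) N f) atTop
      (𝓝 (∫ ω, f (X ω) ∂P)) := by
  have h0 := (h_ident 0).comp hf
  have := strong_law_ae_real (fun k ω => f (Xs k ω)) (h0.integrable_iff.2 hint)
    (fun i j hij => (h_indep.indepFun hij).comp hf hf)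
    (fun i => identDistrib_comp h_ident hf i 0)
  have e : ∫ ω, f (Xs 0 ω) ∂P = ∫ ω, f (X ω) ∂P := h0.integral_eq
  rw [e] at this
  exact this

variable [IsProbabilityMeasure P]

theorem tendstoInDistribution_sqrt_mul_sampleMean (h_indep : iIndepFun Xs P)
    (h_ident : ∀ k, IdentDistrib (Xs k) X P P) {f : E → ℝ} (hf : Measurable f)
    (hsq : MemLp (fun ω => f (X ω)) 2 P) (hmean : ∫ ω, f (X ω) ∂P = 0)
    {Ω' : Type*} [MeasurableSpace Ω'] {P' : Measure Ω'} [IsProbabilityMeasure P'] {Z : Ω' → ℝ}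
    (hZ : HasLaw Z (gaussianReal 0 (variance (fun ω => f (X ω)) P).toNNReal) P') :
    TendstoInDistribution (fun (N : ℕ) ω => √(N : ℝ) * sampleMean (fun k => Xs k ω) N f)
      atTop Z (fun _ => P) P' := by
  have h0 := (h_ident 0).comp hf
  have e1 : ∫ ω, f (Xs 0 ω) ∂P = 0 := h0.integral_eq.trans hmean
  have e2 : variance (fun ω => f (Xs 0 ω)) P = variance (fun ω => f (X ω)) P := h0.variance_eq
  have := tendstoInDistribution_inv_sqrt_mul_sum_sub (X := fun k ω => f (Xs k ω)) (P := P)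
    (Y := Z) (P' := P') (by rw [e2]; exact hZ) (h0.memLp_iff.2 hsq)
    (h_indep.comp (fun _ => f) fun _ => hf) (fun i => identDistrib_comp h_ident hf i 0)
  refine this.congr (fun N => Eventually.of_forall fun ω => ?_) (ae_eq_refl _)
  simp only [e1, mul_zero, sub_zero, sampleMean]
  rcases Nat.eq_zero_or_pos N with rfl | hN
  · simp
  · have h : (0 : ℝ) < N := by positivity
    have h2 : √(N : ℝ) * √(N : ℝ) = N := Real.mul_self_sqrt h.le
    have h3 : 0 < √(N : ℝ) := Real.sqrt_pos.2 h
    rw [inv_mul_eq_div, mul_div_assoc', div_eq_div_iff h3.ne' h.ne', mul_right_comm, h2, mul_comm]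

/-- The mass near a point that is not an atom vanishes in the limit. -/
theorem tendsto_integral_indicator_near {Y : Ω → ℝ} (hY : AEMeasurable Y P) {t : ℝ}
    (ht : P {ω | Y ω = t} = 0) :
    Tendsto (fun m : ℕ => ∫ ω, (if |Y ω - t| ≤ 1 / ((m : ℝ) + 1) then (1 : ℝ) else 0) ∂P) atTop
      (𝓝 0) := by
  rw [show 𝓝 (0 : ℝ) = 𝓝 (∫ _ : Ω, (0 : ℝ) ∂P) by simp]
  refine tendsto_integral_of_dominated_convergence (fun _ => 1) (fun m => ?_)
    (integrable_const _) (fun m => Eventually.of_forall fun ω => ?_) ?_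
  · have hg : Measurable fun z : ℝ => if |z - t| ≤ 1 / ((m : ℝ) + 1) then (1 : ℝ) else 0 :=
      Measurable.ite (measurableSet_le (by fun_prop) measurable_const) measurable_const
        measurable_const
    exact (hg.comp_aemeasurable hY).aestronglyMeasurable
  · split_ifs <;> simp
  · have h : ∀ᵐ ω ∂P, Y ω ≠ t := by rw [ae_iff]; simpa using ht
    filter_upwards [h] with ω hω
    have hpos : 0 < |Y ω - t| := abs_pos.2 (sub_ne_zero.2 hω)
    refine tendsto_const_nhds.congr' ?_
    filter_upwards [(tendsto_order.1 (tendsto_one_div_add_atTop_nhds_zero_nat (𝕜 := ℝ))).2 _ hpos]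
      with m hm
    rw [if_neg hm.not_ge]

/-- Almost surely, the difference quotients of the empirical score converge along every sequence
of thresholds that converges to a point without mass. -/
theorem ae_tendsto_slopeOr (h_indep : iIndepFun Xs P)
    (h_ident : ∀ k, IdentDistrib (Xs k) X P P) {f : E → ℝ} (hf : Measurable f) {t β : ℝ}
    (h0 : 0 ≤ β) (h1 : β ≤ 1) (ht : P {ω | f (X ω) = t} = 0) :
    ∀ᵐ ω ∂P, ∀ s : ℕ → ℝ, Tendsto s atTop (𝓝 t) →
      Tendsto (fun N => slopeOr (fun r => sampleMean (fun k => Xs k ω) N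
          fun z => score β (f z - r))
        (-(1 - β + (2 * β - 1) * cdf (P.map fun ω => f (X ω)) t)) (s N) t) atTop
        (𝓝 (-(1 - β + (2 * β - 1) * cdf (P.map fun ω => f (X ω)) t))) := by
  have hX : AEMeasurable X P := (h_ident 0).aemeasurable_snd
  have hfX : AEMeasurable (fun ω => f (X ω)) P := hf.comp_aemeasurable hX
  have hint : ∀ {g : E → ℝ}, Measurable g → (∀ z, g z = 1 ∨ g z = 0) →
      Integrable (fun ω => g (X ω)) P := fun {g} hg h =>
    Integrable.of_bound (hg.comp_aemeasurable hX).aestronglyMeasurable 1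
      (Eventually.of_forall fun ω => by rcases h (X ω) with h | h <;> simp [h])
  have hm1 : Measurable fun z : E => if f z ≤ t then (1 : ℝ) else 0 :=
    Measurable.ite (measurableSet_le hf measurable_const) measurable_const measurable_const
  have hm2 : ∀ m : ℕ, Measurable fun z : E =>
      if |f z - t| ≤ 1 / ((m : ℝ) + 1) then (1 : ℝ) else 0 :=
    fun m => Measurable.ite (measurableSet_le (by fun_prop) measurable_const) measurable_const
      measurable_const
  have hcdf : ∫ ω, (if f (X ω) ≤ t then (1 : ℝ) else 0) ∂P = cdf (P.map fun ω => f (X ω)) t := by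
    have : IsProbabilityMeasure (P.map fun ω => f (X ω)) := Measure.isProbabilityMeasure_map hfX
    rw [cdf_eq_real, ← integral_indicator_one measurableSet_Iic,
      integral_map hfX (measurable_one.indicator measurableSet_Iic).aestronglyMeasurable]
    simp [Set.indicator_apply]
  have a1 := tendsto_sampleMean h_indep h_ident hm1
    (hint hm1 fun z => by split_ifs <;> simp)
  -- Countably many windows suffice, so one null set serves all threshold sequences, including
  -- data-dependent ones.
  have a2 := ae_all_iff.2 fun m => tendsto_sampleMean h_indep h_ident (hm2 m)
    (hint (hm2 m) fun z => by split_ifs <;> simp)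
  rw [hcdf] at a1
  filter_upwards [a1, a2] with ω b1 b2 s hs
  exact tendsto_slopeOr_sampleMean_score h0 h1 hs b1 b2 (tendsto_integral_indicator_near hfX ht)

/-- Strong consistency of the empirical expectile. -/
theorem ae_tendsto_expectile (h_indep : iIndepFun Xs P)
    (h_ident : ∀ k, IdentDistrib (Xs k) X P P) {f : E → ℝ} (hf : Measurable f)
    (hint : Integrable (fun ω => f (X ω)) P) {β : ℝ} (hβ : β ∈ Set.Ioo (0 : ℝ) 1) :
    ∀ᵐ ω ∂P, Tendsto (fun N => expectile β (empiricalLaw N fun k => f (Xs k ω))) atTop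
      (𝓝 (expectile β (P.map fun ω => f (X ω)))) := by
  have hX : AEMeasurable X P := (h_ident 0).aemeasurable_snd
  have hfX : AEMeasurable (fun ω => f (X ω)) P := hf.comp_aemeasurable hX
  have : IsProbabilityMeasure (P.map fun ω => f (X ω)) := Measure.isProbabilityMeasure_map hfX
  have hi := (integrable_map_id hfX).2 hint
  set y := expectile β (P.map fun ω => f (X ω))
  have hscore := integrable_score hi β y
  have hmeas : Measurable fun z : ℝ => score β (z - y) :=
    (measurable_score β).comp (measurable_id.sub_const y)
  have hy : ∫ ω, score β (f (X ω) - y) ∂P = 0 := by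
    rw [← integral_map hfX hmeas.aestronglyMeasurable (f := fun z => score β (z - y))]
    exact integral_score_expectile hi hβ
  have a := tendsto_sampleMean h_indep h_ident (hmeas.comp hf)
    ((integrable_map_measure hmeas.aestronglyMeasurable hfX).1 hscore)
  rw [show ∫ ω, ((fun z => score β (z - y)) ∘ f) (X ω) ∂P = 0 from hy] at a
  filter_upwards [a] with ω hω
  have hc : 0 < min β (1 - β) := lt_min hβ.1 (by linarith [hβ.2])
  have h2 : Tendsto (fun N => |sampleMean (fun k => Xs k ω) N (fun z => score β (f z - y))| /
      min β (1 - β)) atTop (𝓝 0) := by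
    have h3 := (hω.abs).div_const (min β (1 - β))
    rwa [abs_zero, zero_div] at h3
  rw [tendsto_iff_dist_tendsto_zero]
  refine squeeze_zero' (Eventually.of_forall fun N => dist_nonneg) ?_ h2
  filter_upwards [eventually_gt_atTop 0] with N hN
  have : NeZero N := ⟨hN.ne'⟩
  have hie := integrable_empiricalLaw hN (fun k => f (Xs k ω)) (fun x => x)
  -- The lower slope bound controls the distance from y to the empirical zero by the empirical score
  -- at y, which tends to 0.
  have h3 := mul_abs_sub_le_integral_score hie (min_le_left β (1 - β)) (min_le_right _ _)
    (expectile β (empiricalLaw N fun k => f (Xs k ω))) y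
  rw [integral_score_expectile hie hβ, integral_score_empiricalLaw, zero_sub, abs_neg] at h3
  rw [Real.dist_eq, le_div_iff₀ hc, mul_comm]
  exact h3

end Sampling

/-! ### Algebra of the linearization and of the variance. -/

theorem abs_score_le {β : ℝ} (h0 : 0 ≤ β) (h1 : β ≤ 1) (z : ℝ) : |score β z| ≤ |z| := by
  unfold score
  rcases le_total 0 z with h | h
  · rw [max_eq_left h, max_eq_right (by linarith : -z ≤ 0), abs_of_nonneg h, abs_le]
    constructor <;> nlinarith
  · rw [max_eq_right h, max_eq_left (by linarith : 0 ≤ -z), abs_of_nonpos h, abs_le]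
    constructor <;> nlinarith

/-- The asymptotic linearization of the estimator in terms of expectile scores. -/
theorem dotProduct_vecV {n : ℕ} {α t q θ₁ θ₂ G : ℝ} {y f m D e : Fin n → ℝ} (hα : α ≠ 0)
    (hθ₂ : θ₂ ≠ 0) (hq : q = θ₁ / θ₂) (hD : ∀ i, D i ≠ 0) (he : ∀ i, e i ≠ 0)
    (hm : ∀ i, m i = (1 - α) * D i) (hf : ∀ i, f i = e i / D i) (x : Fin n → ℝ) :
    ∑ a, ((gradHT G f m D)ᵀ *ᵥ ![1 / (α * θ₂), -θ₁ / (α * θ₂ ^ 2)]) a * vecV t y x a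
      = 1 / (α * θ₂) * (score q ((∑ i, x i) - t)
          - ∑ i, (1 - q + (2 * q - 1) * G) / e i * score α (x i - y i))
        - 1 / (α * θ₂) * ∑ i, (1 - q + (2 * q - 1) * G) / e i * ((1 - α) * y i) := by
  have hv : ∀ i, (if x i ≤ y i then y i - x i else 0) = max (-(x i - y i)) 0 := fun i => by
    split_ifs with h
    · rw [max_eq_left (by linarith)]; ring
    · rw [max_eq_right (by linarith)]
  have hx : ∀ i, x i = y i + max (x i - y i) 0 - max (-(x i - y i)) 0 := fun i => by
    rcases le_total 0 (x i - y i) with h | h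
    · rw [max_eq_left h, max_eq_right (by linarith : -(x i - y i) ≤ 0)]; ring
    · rw [max_eq_right h, max_eq_left (by linarith : 0 ≤ -(x i - y i))]; ring
  have hθ₁ : θ₁ = q * θ₂ := by rw [hq]; field_simp
  have hg : -θ₁ / (α * θ₂ ^ 2) = -(q / (α * θ₂)) := by rw [hθ₁]; field_simp
  -- Here D - 2m = (2α-1)D, f = e/D, and (1-G) - q(1-2G) = 1 - q + (2q-1)G. With u, v the positive
  -- and negative parts of x - y, what remains is (2α-1)v - (1-α)(y+u-v) = -score - (1-α)y.
  have hterm : ∀ i,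
      ((1 - G) / f i * ((D i - 2 * m i) / D i ^ 2) * (1 / (α * θ₂)) +
        (1 - 2 * G) / f i * ((D i - 2 * m i) / D i ^ 2) * -(q / (α * θ₂))) *
          max (-(x i - y i)) 0 +
      ((1 - G) / f i * (-m i / D i ^ 2) * (1 / (α * θ₂)) +
        (1 - 2 * G) / f i * (-m i / D i ^ 2) * -(q / (α * θ₂))) * x i
      = -(1 / (α * θ₂)) * ((1 - q + (2 * q - 1) * G) / e i * score α (x i - y i))
        - 1 / (α * θ₂) * ((1 - q + (2 * q - 1) * G) / e i * ((1 - α) * y i)) := by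
    intro i
    have h1 := hD i
    have h2 := he i
    have hxi := hx i
    rw [hf i, hm i, score]
    generalize max (x i - y i) 0 = u at hxi ⊢
    generalize max (-(x i - y i)) 0 = v at hxi ⊢
    rw [hxi]
    field_simp
    ring
  simp only [Fintype.sum_sum_type, Fintype.sum_prod_type, Fin.sum_univ_two, Matrix.mulVec,
    dotProduct, Matrix.transpose_apply, gradHT, Matrix.of_apply, vecV, Matrix.cons_val_zero,
    Matrix.cons_val_one, hv, hg]
  rw [Finset.sum_congr rfl fun i _ => hterm i, Finset.sum_sub_distrib, ← Finset.mul_sum,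
    ← Finset.mul_sum, score_eq]
  ring

theorem variance_sum_mul {Ω ι : Type*} [MeasurableSpace Ω] {P : Measure Ω}
    [IsProbabilityMeasure P] [Fintype ι] {V : ι → Ω → ℝ} (hV : ∀ a, MemLp (V a) 2 P)
    (A : ι → ℝ) (Sigma : Matrix ι ι ℝ) (hSigma : ∀ a b, Sigma a b = covariance (V a) (V b) P) :
    variance (fun ω => ∑ a, A a * V a ω) P = A ⬝ᵥ (Sigma *ᵥ A) := by
  have hA : ∀ a, MemLp (fun ω => A a * V a ω) 2 P := fun a => (hV a).const_mul _
  rw [← covariance_self (Finset.aemeasurable_fun_sum _ fun a _ => (hA a).aemeasurable),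
    covariance_fun_sum_fun_sum hA hA]
  simp only [dotProduct, Matrix.mulVec, covariance_const_mul_left, covariance_const_mul_right,
    hSigma, Finset.mul_sum]
  refine Finset.sum_congr rfl fun a _ => Finset.sum_congr rfl fun b _ => by ring

theorem memLp_vecV {n : ℕ} {Ω : Type*} [MeasurableSpace Ω] {P : Measure Ω}
    [IsProbabilityMeasure P] {X : Ω → Fin n → ℝ} (h_sq : ∀ i, MemLp (fun ω => X ω i) 2 P)
    (t : ℝ) (y : Fin n → ℝ) (a : Idx n) : MemLp (fun ω => vecV t y (X ω) a) 2 P := by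
  have hS : MemLp (fun ω => (∑ i, X ω i) - t) 2 P :=
    (memLp_finsetSum _ fun i _ => h_sq i).sub (memLp_const t)
  match a with
  | Sum.inl 0 => exact hS.pos_part
  | Sum.inl 1 => exact hS.abs
  | Sum.inr (i, 0) =>
    refine ((h_sq i).sub (memLp_const (y i))).neg_part.congr_norm ?_ ?_
    · have : Measurable fun z : ℝ => if z ≤ y i then y i - z else 0 :=
        Measurable.ite measurableSet_Iic (by fun_prop) measurable_const
      exact (this.comp_aemeasurable (h_sq i).aemeasurable).aestronglyMeasurable
    · refine Eventually.of_forall fun ω => ?_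
      simp only [vecV]
      congr 1
      simp only [Pi.sub_apply]
      split_ifs with h
      · rw [max_eq_left (by linarith)]; ring
      · rw [max_eq_right (by linarith)]
  | Sum.inr (i, 1) => exact h_sq i

/-- Exact expansion of the estimation error in terms of sample means of scores. -/
theorem sub_eq_of_slopes {ι : Type*} [Fintype ι] {α q a b r U t tN s : ℝ} {y T M e : ι → ℝ}
    (hα : α ≠ 0) (hb : b ≠ 0) (he : ∀ i, e i ≠ 0) (ht : t = ∑ i, y i) (htN : tN = ∑ i, T i)
    (hM : ∀ i, (T i - y i) * e i = 0 - M i) (hU : (tN - t) * s = a - q * b - U) :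
    r * (1 / α * (a / b) - 1 / α * q)
      = 1 / (α * b) * (r * U) + ∑ i, -(1 / (α * b)) * (s / e i) * (r * M i) := by
  have h1 : tN - t = ∑ i, -(M i / e i) := by
    rw [ht, htN, ← Finset.sum_sub_distrib]
    refine Finset.sum_congr rfl fun i _ => ?_
    have := he i
    rw [← neg_div, eq_div_iff this, hM i, zero_sub]
  have h2 : ∑ i, -(1 / (α * b)) * (s / e i) * (r * M i)
      = r * (1 / (α * b)) * ((tN - t) * s) := by
    rw [h1, Finset.sum_mul, Finset.mul_sum]
    refine Finset.sum_congr rfl fun i _ => ?_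
    ring
  rw [h2, hU]
  field_simp
  ring

end DQ

end

/-! ### Assembly of the theorem. -/

theorem theorem6 {Ω : Type*} [MeasurableSpace Ω] (P : Measure Ω) [IsProbabilityMeasure P]
    (n : ℕ) (α : ℝ) (hα : α ∈ Set.Ioo (0 : ℝ) (1 / 2))
    -- the portfolio and its i.i.d. samples
    (X : Ω → Fin n → ℝ) (Xs : ℕ → Ω → Fin n → ℝ)
    (h_indep : iIndepFun Xs P) (h_ident : ∀ k, IdentDistrib (Xs k) X P P)
    (h_sq : ∀ i, MemLp (fun ω => X ω i) 2 P)
    -- the quantities that enter the asymptotic variance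
    (S : Ω → ℝ) (hS : S = fun ω => ∑ i, X ω i)
    (ν : Fin n → Measure ℝ) (hν : ∀ i, ν i = P.map fun ω => X ω i)
    (t θ₁ θ₂ : ℝ) (ht : t = ∑ i, DQ.expectile α (ν i))
    (hθ₁ : θ₁ = ∫ ω, max (S ω - t) 0 ∂P) (hθ₂ : θ₂ = ∫ ω, |S ω - t| ∂P)
    (y m mneg D f : Fin n → ℝ)
    (hy : ∀ i, y i = DQ.genInverse (DQ.tildeF (ν i)) (1 - α))
    (hm : ∀ i, m i = ∫ ω, X ω i ∂P)
    (hmneg : ∀ i, mneg i = ∫ ω, max (-(X ω i - y i)) 0 ∂P)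
    (hD : ∀ i, D i = 2 * mneg i + m i - y i)
    (hf : ∀ i, f i = DQ.tildeDensity (ν i) (y i))
    (gradG : Fin 2 → ℝ) (hgradG : gradG = ![1 / (α * θ₂), -θ₁ / (α * θ₂ ^ 2)])
    (A : DQ.Idx n → ℝ)
    (hA : A = (DQ.gradHT (cdf (P.map S) t) f mneg D)ᵀ *ᵥ gradG)
    (Sigma : Matrix (DQ.Idx n) (DQ.Idx n) ℝ)
    (hSigma : ∀ a b, Sigma a b =
      covariance (fun ω => DQ.vecV t y (X ω) a) (fun ω => DQ.vecV t y (X ω) b) P)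
    (σsq : ℝ) (hσsq : σsq = A ⬝ᵥ (Sigma *ᵥ A))
    -- the distribution functions are continuous at the points where they are linearized
    (h_atom : ∀ i, P {ω | X ω i = y i} = 0) (h_atom_sum : P {ω | S ω = t} = 0) :
    -- the quantities in the variance are well defined
    0 < θ₂ ∧
    (∀ i, 0 < D i ∧ DifferentiableAt ℝ (DQ.tildeF (ν i)) (y i) ∧ 0 < f i) ∧
    0 ≤ σsq ∧
    -- the estimator is the diversification quotient of the empirical joint law
    (∀ N : ℕ, 0 < N → ∀ ω, DQ.dqExEstimator α N (fun k => Xs k ω) =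
      DQ.dqEx α (DQ.empiricalLaw N fun k => Xs k ω)) ∧
    -- asymptotic normality
    TendstoInDistribution
      (fun (N : ℕ) ω => √(N : ℝ) *
        (DQ.dqExEstimator α N (fun k => Xs k ω) - DQ.dqEx α (P.map X)))
      atTop id (fun _ => P) (gaussianReal 0 σsq.toNNReal) := by
  have hα' : α ∈ Set.Ioo (0 : ℝ) 1 := ⟨hα.1, by linarith [hα.2]⟩
  have hα0 : α ≠ 0 := hα.1.ne'
  have hX : AEMeasurable X P := (h_ident 0).aemeasurable_snd
  have hXi : ∀ i, AEMeasurable (fun ω => X ω i) P := fun i => (h_sq i).aemeasurable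
  have hint : ∀ i, Integrable (fun ω => X ω i) P := fun i => (h_sq i).integrable one_le_two
  have hSm : AEMeasurable S P := by rw [hS]; fun_prop
  have hSint : Integrable S P := by
    rw [hS]; exact integrable_finsetSum _ fun i _ => hint i
  have hprob : ∀ i, IsProbabilityMeasure (ν i) := fun i => by
    rw [hν i]; exact Measure.isProbabilityMeasure_map (hXi i)
  have hνint : ∀ i, Integrable (fun x => x) (ν i) := fun i => by
    rw [hν i]; exact (DQ.integrable_map_id (hXi i)).2 (hint i)
  have hye : ∀ i, y i = DQ.expectile α (ν i) := fun i => by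
    rw [hy i, DQ.genInverse_tildeF (hνint i) hα']
  have hty : t = ∑ i, y i := by simp_rw [ht, hye]
  have hat : ∀ i, ν i {y i} = 0 := fun i => by
    rw [hν i, Measure.map_apply_of_aemeasurable (hXi i) (measurableSet_singleton _)]
    exact h_atom i
  have hmneg' : ∀ i, mneg i = ∫ x, max (-(x - y i)) 0 ∂(ν i) := fun i => by
    rw [hmneg i, hν i, integral_map (hXi i) (by fun_prop)]
  have hDabs : ∀ i, D i = ∫ x, |x - y i| ∂(ν i) := fun i => by
    rw [← DQ.two_mul_negPart_add (hνint i), hD i, hmneg' i, hm i, hν i,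
      DQ.integral_map_id (hXi i)]
  have hDpos : ∀ i, 0 < D i := fun i => by
    rw [hDabs i]; exact DQ.integral_abs_sub_pos (hνint i) (hat i)
  have hmD : ∀ i, mneg i = (1 - α) * D i := fun i => by
    have h0 := DQ.integral_score_expectile (hνint i) hα'
    rw [← hye i, DQ.integral_score (hνint i)] at h0
    have h1 := DQ.integral_posPart_add_negPart (hνint i) (y i)
    rw [hDabs i, hmneg' i]
    linear_combination -h0 + (1 - α) * h1
  set e : Fin n → ℝ := fun i => 1 - α + (2 * α - 1) * cdf (ν i) (y i) with he_def
  have hder : ∀ i, HasDerivAt (DQ.tildeF (ν i)) (e i / D i) (y i) := fun i => by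
    rw [hDabs i]; exact DQ.hasDerivAt_tildeF (hνint i) hα' (hye i) (hat i)
  have hfe : ∀ i, f i = e i / D i := fun i => by
    rw [hf i, DQ.tildeDensity, (hder i).deriv]
  -- e i is the convex combination (1-α)(1-F) + αF of 1-α and α.
  have hepos : ∀ i, 0 < e i := fun i => by
    have h0 := cdf_nonneg (ν i) (y i)
    have h1 := cdf_le_one (ν i) (y i)
    have h2 := hα.1
    have h3 := hα.2
    simp only [he_def]
    nlinarith
  have hSprob : IsProbabilityMeasure (P.map S) := Measure.isProbabilityMeasure_map hSm
  have hθ₂pos : 0 < θ₂ := by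
    have h0 : P.map S {t} = 0 := by
      rw [Measure.map_apply_of_aemeasurable hSm (measurableSet_singleton _)]
      exact h_atom_sum
    have h1 := DQ.integral_abs_sub_pos ((DQ.integrable_map_id hSm).2 hSint) h0
    rwa [integral_map hSm (by fun_prop), ← hθ₂] at h1
  have hμprob : IsProbabilityMeasure (P.map X) := Measure.isProbabilityMeasure_map hX
  have hμint : ∀ i, Integrable (fun x : Fin n → ℝ => x i) (P.map X) := fun i =>
    (integrable_map_measure (measurable_pi_apply i).aestronglyMeasurable hX).2 (hint i)
  have hmap : ∀ i, (P.map X).map (fun x => x i) = ν i := fun i => by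
    rw [hν i, AEMeasurable.map_map_of_aemeasurable (measurable_pi_apply i).aemeasurable hX]; rfl
  have htμ : t = ∑ i, DQ.expectile α ((P.map X).map fun x => x i) := by simp_rw [hmap, ht]
  have hθ₁μ : ∫ x, max ((∑ i, x i) - t) 0 ∂(P.map X) = θ₁ := by
    rw [hθ₁, hS, integral_map hX (by fun_prop)]
  have hθ₂μ : ∫ x, |(∑ i, x i) - t| ∂(P.map X) = θ₂ := by
    rw [hθ₂, hS, integral_map hX (by fun_prop)]
  set q := θ₁ / θ₂ with hq
  have hdq : DQ.dqEx α (P.map X) = 1 / α * q := by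
    rw [DQ.dqEx_eq hμint hα htμ, hθ₁μ, hθ₂μ]
  have hθ₁0 : 0 ≤ θ₁ := by rw [hθ₁]; exact integral_nonneg fun ω => le_max_right _ _
  have hq0 : 0 ≤ q := div_nonneg hθ₁0 hθ₂pos.le
  have hq1 : q ≤ 1 := by
    have := DQ.two_mul_integral_posPart_le hμint hα htμ
    rw [hθ₁μ, hθ₂μ] at this
    rw [hq, div_le_one hθ₂pos]
    linarith
  -- the scores of the aggregate and of the components
  set G := cdf (P.map S) t with hG
  set d := 1 - q + (2 * q - 1) * G with hd
  set φ : Option (Fin n) → (Fin n → ℝ) → ℝ := fun j x =>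
    j.elim (DQ.score q ((∑ i, x i) - t)) fun i => DQ.score α (x i - y i) with hφ
  set a : Option (Fin n) → ℝ := fun j =>
    j.elim (1 / (α * θ₂)) fun i => -(1 / (α * θ₂)) * (d / e i) with ha
  have hφm : ∀ j, Measurable (φ j) := by
    rintro (_ | i)
    · exact (DQ.measurable_score q).comp (by fun_prop)
    · exact (DQ.measurable_score α).comp (by fun_prop)
  have hφsq : ∀ j, MemLp (fun ω => φ j (X ω)) 2 P := by
    rintro (_ | i)
    · have h1 : MemLp (fun ω => (∑ i, X ω i) - t) 2 P :=
        (memLp_finsetSum _ fun i _ => h_sq i).sub (memLp_const t)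
      exact h1.mono ((hφm none).comp_aemeasurable hX).aestronglyMeasurable
        (Eventually.of_forall fun ω => DQ.abs_score_le hq0 hq1 _)
    · have h1 : MemLp (fun ω => X ω i - y i) 2 P := (h_sq i).sub (memLp_const (y i))
      exact h1.mono ((hφm (some i)).comp_aemeasurable hX).aestronglyMeasurable
        (Eventually.of_forall fun ω => DQ.abs_score_le hα'.1.le hα'.2.le _)
  -- For the aggregate, q is exactly the level that balances the score at t: θ₁ - qθ₂ = 0.
  have hφmean : ∀ j, ∫ ω, φ j (X ω) ∂P = 0 := by
    rintro (_ | i)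
    · have h1 : ∀ ω, φ none (X ω) = max (S ω - t) 0 - q * |S ω - t| := fun ω => by
        rw [hS]; exact DQ.score_eq _ _
      have h2 : Integrable (fun ω => S ω - t) P := hSint.sub (integrable_const t)
      simp_rw [h1]
      rw [integral_sub h2.pos_part (h2.abs.const_mul _), integral_const_mul, ← hθ₁, ← hθ₂, hq,
        div_mul_cancel₀ _ hθ₂pos.ne', sub_self]
    · have h1 := DQ.integral_score_expectile (hνint i) hα'
      have h2 : Measurable fun z : ℝ => DQ.score α (z - y i) :=
        (DQ.measurable_score α).comp (measurable_id.sub_const (y i))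
      rw [← hye i, hν i, integral_map (hXi i) h2.aestronglyMeasurable] at h1
      exact h1
  set Lin : (Fin n → ℝ) → ℝ := fun x => ∑ j, a j * φ j x with hLin
  have hLinm : Measurable Lin := Finset.measurable_fun_sum _ fun j _ => (hφm j).const_mul _
  have hLinsq : MemLp (fun ω => Lin (X ω)) 2 P :=
    memLp_finsetSum _ fun j _ => (hφsq j).const_mul (a j)
  have hLinmean : ∫ ω, Lin (X ω) ∂P = 0 := by
    simp only [hLin]
    rw [integral_finsetSum _ fun j _ => ((hφsq j).integrable one_le_two).const_mul (a j)]
    simp [integral_const_mul, hφmean]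
  have hvar : σsq = variance (fun ω => Lin (X ω)) P := by
    rw [hσsq, ← DQ.variance_sum_mul (DQ.memLp_vecV h_sq t y) A Sigma hSigma, hA, hgradG]
    simp_rw [DQ.dotProduct_vecV (x := X _) hα0 hθ₂pos.ne' hq (fun i => (hDpos i).ne')
      (fun i => (hepos i).ne') hmD hfe]
    have h1 : ∀ x, 1 / (α * θ₂) * (DQ.score q ((∑ i, x i) - t)
          - ∑ i, (1 - q + (2 * q - 1) * G) / e i * DQ.score α (x i - y i)) = Lin x := by
      intro x
      simp only [hLin, Fintype.sum_option, ha, hφ, Option.elim]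
      rw [mul_sub, Finset.mul_sum, sub_eq_add_neg, ← Finset.sum_neg_distrib]
      congr 1
      refine Finset.sum_congr rfl fun i _ => ?_
      simp only [hd]
      ring
    simp_rw [h1]
    exact variance_sub_const hLinsq.aestronglyMeasurable _
  refine ⟨hθ₂pos, fun i => ⟨hDpos i, (hder i).differentiableAt, ?_⟩, ?_,
    fun N hN ω => DQ.dqExEstimator_eq_dqEx hN hα _, ?_⟩
  · rw [hfe i]; exact div_pos (hepos i) (hDpos i)
  · rw [hvar]; exact variance_nonneg _ _
  -- the random coefficients, as functions of the data
  set T : ℕ → (ℕ → Fin n → ℝ) → Fin n → ℝ := fun N x i =>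
    DQ.expectile α (DQ.empiricalLaw N fun k => x k i) with hT
  set tN : ℕ → (ℕ → Fin n → ℝ) → ℝ := fun N x => ∑ i, T N x i with htN
  set bN : ℕ → (ℕ → Fin n → ℝ) → ℝ := fun N x =>
    DQ.sampleMean x N fun z => |(∑ i, z i) - tN N x| with hbN
  set sN : ℕ → (ℕ → Fin n → ℝ) → ℝ := fun N x => DQ.slopeOr
    (fun r => DQ.sampleMean x N fun z => DQ.score q ((∑ i, z i) - r)) (-d) (tN N x) t with hsN
  set eN : Fin n → ℕ → (ℕ → Fin n → ℝ) → ℝ := fun i N x => DQ.slopeOr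
    (fun r => DQ.sampleMean x N fun z => DQ.score α (z i - r)) (-e i) (T N x i) (y i) with heN
  have hTm : ∀ N i, Measurable fun x => T N x i := fun N i =>
    (DQ.measurable_expectile_empiricalLaw hα' N).comp
      (measurable_pi_lambda _ fun k => by fun_prop)
  have htNm : ∀ N, Measurable (tN N) := fun N =>
    Finset.measurable_fun_sum _ fun i _ => hTm N i
  have hbNm : ∀ N, Measurable (bN N) := fun N => by
    have := htNm N
    simp only [hbN, DQ.sampleMean]
    exact (Finset.measurable_fun_sum _ fun k _ => by fun_prop).div_const _
  have hsum : Measurable fun z : Fin n → ℝ => ∑ i, z i := by fun_prop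
  have hsNm : ∀ N, Measurable (sN N) := fun N => DQ.measurable_slopeOr _ _ (htNm N)
    (DQ.measurable_sampleMean_score N hsum q (htNm N))
    (DQ.measurable_sampleMean_score N hsum q measurable_const)
  have heNm : ∀ i N, Measurable (eN i N) := fun i N => DQ.measurable_slopeOr _ _ (hTm N i)
    (DQ.measurable_sampleMean_score N (measurable_pi_apply i) α (hTm N i))
    (DQ.measurable_sampleMean_score N (measurable_pi_apply i) α measurable_const)
  have hdata : AEMeasurable (fun ω k => Xs k ω) P :=
    aemeasurable_pi_lambda _ fun k => (h_ident k).aemeasurable_fst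
  -- The coefficients `a` with θ₂ replaced by `bN` and d / e i by `sN / eN i`; the limits -d and -e
  -- i carry signs that cancel.
  set c : Option (Fin n) → ℕ → Ω → ℝ := fun j N ω =>
    j.elim (1 / (α * bN N fun k => Xs k ω)) fun i =>
      -(1 / (α * bN N fun k => Xs k ω)) *
        ((sN N fun k => Xs k ω) / eN i N fun k => Xs k ω) with hc
  have hcm : ∀ j N, AEMeasurable (c j N) P := by
    have h1 : ∀ N, Measurable fun x => 1 / (α * bN N x) := fun N =>
      measurable_const.div ((hbNm N).const_mul α)
    rintro (_ | i) N
    · exact (h1 N).comp_aemeasurable hdata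
    · exact ((h1 N).neg.mul ((hsNm N).div (heNm i N))).comp_aemeasurable hdata
  -- almost sure limits
  have hTlim : ∀ᵐ ω ∂P, ∀ i, Tendsto (fun N => T N (fun k => Xs k ω) i) atTop (𝓝 (y i)) := by
    refine ae_all_iff.2 fun i => ?_
    have := DQ.ae_tendsto_expectile h_indep h_ident (measurable_pi_apply i) (hint i) hα'
    rwa [← hν i, ← hye i] at this
  have heNlim := ae_all_iff.2 fun i => DQ.ae_tendsto_slopeOr h_indep h_ident
    (measurable_pi_apply i) hα'.1.le hα'.2.le (h_atom i)
  have hsNlim := DQ.ae_tendsto_slopeOr h_indep h_ident hsum hq0 hq1 (t := t)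
    (by rw [hS] at h_atom_sum; exact h_atom_sum)
  have hblim := DQ.tendsto_sampleMean h_indep h_ident (f := fun z => |(∑ i, z i) - t|)
    (by fun_prop) (by
      have := (hSint.sub (integrable_const t)).abs
      rw [hS] at this; exact this)
  have hlim : ∀ᵐ ω ∂P, Tendsto (fun N => bN N fun k => Xs k ω) atTop (𝓝 θ₂) ∧
      Tendsto (fun N => sN N fun k => Xs k ω) atTop (𝓝 (-d)) ∧
      ∀ i, Tendsto (fun N => eN i N fun k => Xs k ω) atTop (𝓝 (-e i)) := by
    filter_upwards [hTlim, heNlim, hsNlim, hblim] with ω h1 h2 h3 h4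
    have h5 : Tendsto (fun N => tN N fun k => Xs k ω) atTop (𝓝 t) := by
      rw [hty]; exact tendsto_finsetSum _ fun i _ => h1 i
    refine ⟨?_, ?_, fun i => ?_⟩
    · have h6 : ∫ ω, |(∑ i, X ω i) - t| ∂P = θ₂ := by rw [hθ₂, hS]
      rw [h6] at h4
      have h7 : Tendsto (fun N => |(tN N fun k => Xs k ω) - t|) atTop (𝓝 0) := by
        simpa using (h5.sub_const t).abs
      refine tendsto_of_tendsto_of_dist h4 (squeeze_zero' (Eventually.of_forall fun _ =>
        dist_nonneg) ?_ h7)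
      filter_upwards [eventually_gt_atTop 0] with N hN
      rw [Real.dist_eq, ← DQ.sampleMean_sub]
      refine (DQ.abs_sampleMean_le _ _ _).trans ((DQ.sampleMean_mono _ _ fun z => ?_).trans
        (DQ.sampleMean_const (fun k => Xs k ω) hN _).le)
      refine (abs_abs_sub_abs_le_abs_sub _ _).trans (le_of_eq ?_)
      congr 1; ring
    · have := h3 _ h5
      rw [hS] at hG
      rw [← hG] at this
      exact this
    · have := h2 i _ (h1 i)
      rw [← hν i] at this
      exact this
  have hcoef : ∀ j, ∀ᵐ ω ∂P, Tendsto (fun N => c j N ω) atTop (𝓝 (a j)) := by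
    have h1 : α * θ₂ ≠ 0 := mul_ne_zero hα0 hθ₂pos.ne'
    rintro (_ | i)
    · filter_upwards [hlim] with ω hω
      exact tendsto_const_nhds.div (hω.1.const_mul α) h1
    · filter_upwards [hlim] with ω hω
      have := ((tendsto_const_nhds (x := (1 : ℝ))).div (hω.1.const_mul α) h1).neg.mul
        (hω.2.1.div (hω.2.2 i) (neg_ne_zero.2 (hepos i).ne'))
      rw [neg_div_neg_eq] at this
      exact this
  have hest : ∀ (N : ℕ), 0 < N → ∀ x : ℕ → Fin n → ℝ, DQ.dqExEstimator α N x =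
      1 / α * ((DQ.sampleMean x N fun z => max ((∑ i, z i) - tN N x) 0) / bN N x) := by
    intro N hN x
    simp only [hbN, DQ.sampleMean]
    rw [div_div_div_cancel_right₀ (by positivity)]
    rfl
  have hestm : ∀ N, Measurable (DQ.dqExEstimator α N : (ℕ → Fin n → ℝ) → ℝ) := by
    intro N
    have h1 := htNm N
    have h2 : Measurable fun x : ℕ → Fin n → ℝ =>
        ∑ k ∈ Finset.range N, max ((∑ i, x k i) - tN N x) 0 :=
      Finset.measurable_fun_sum _ fun k _ => by fun_prop
    have h3 : Measurable fun x : ℕ → Fin n → ℝ =>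
        ∑ k ∈ Finset.range N, |(∑ i, x k i) - tN N x| :=
      Finset.measurable_fun_sum _ fun k _ => by fun_prop
    exact (h2.div h3).const_mul (1 / α)
  refine DQ.tendstoInDistribution_sum_mul (c := c) (a := a)
    (W := fun j N ω => √(N : ℝ) * DQ.sampleMean (fun k => Xs k ω) N (φ j))
    (μ := fun j => gaussianReal 0 (variance (fun ω => φ j (X ω)) P).toNNReal)
    (fun j => DQ.tendstoInDistribution_sqrt_mul_sampleMean h_indep h_ident (hφm j) (hφsq j)
      (hφmean j) HasLaw.id) hcm hcoef ?_ ?_ ?_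
  -- With the limiting coefficients the combination is itself a sample mean, that of `Lin`, so the
  -- scalar limit theorem covers it.
  · have h1 := DQ.tendstoInDistribution_sqrt_mul_sampleMean h_indep h_ident hLinm hLinsq
      hLinmean (Z := id) (P' := gaussianReal 0 σsq.toNNReal) (by rw [hvar]; exact HasLaw.id)
    refine h1.congr (fun N => Eventually.of_forall fun ω => ?_) (ae_eq_refl _)
    simp only [DQ.sampleMean, hLin]
    rw [Finset.sum_comm, Finset.sum_div, Finset.mul_sum]
    refine Finset.sum_congr rfl fun j _ => ?_
    rw [← Finset.mul_sum]
    ring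
  · intro N
    exact (((hestm N).sub_const _).const_mul _).comp_aemeasurable hdata
  -- The exact expansion divides by `bN` and `eN`, which are nonzero only for large N, depending on
  -- ω.
  · filter_upwards [hlim] with ω hω
    have hb := hω.1.eventually_ne hθ₂pos.ne'
    have he := eventually_all.2 fun i =>
      (hω.2.2 i).eventually_ne (neg_ne_zero.2 (hepos i).ne')
    filter_upwards [hb, he, eventually_gt_atTop 0] with N hb he hN
    have : NeZero N := ⟨hN.ne'⟩
    rw [hest N hN, hdq, Fintype.sum_option]
    refine DQ.sub_eq_of_slopes (y := y) (T := T N fun k => Xs k ω) (t := t)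
      (tN := tN N fun k => Xs k ω) hα0 hb he hty rfl (fun i => ?_) ?_
    · have h1 := DQ.sub_mul_slopeOr (fun r => DQ.sampleMean (fun k => Xs k ω) N
        fun z => DQ.score α (z i - r)) (-e i) (T N (fun k => Xs k ω) i) (y i)
      have h2 := DQ.integral_score_expectile
        (DQ.integrable_empiricalLaw hN (fun k => Xs k ω i) fun x => x) hα'
      rw [DQ.integral_score_empiricalLaw] at h2
      have h3 : (DQ.sampleMean (fun k => Xs k ω) N
        fun z => DQ.score α (z i - T N (fun k => Xs k ω) i)) = 0 := h2
      beta_reduce at h1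
      rw [h3] at h1
      exact h1
    · have h1 := DQ.sub_mul_slopeOr (fun r => DQ.sampleMean (fun k => Xs k ω) N
        fun z => DQ.score q ((∑ i, z i) - r)) (-d) (tN N fun k => Xs k ω) t
      beta_reduce at h1
      refine h1.trans ?_
      simp_rw [DQ.score_eq q (_ - tN N _)]
      rw [DQ.sampleMean_sub, DQ.sampleMean_const_mul]
      rfl
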